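/- Let $K$ be an arbitrary field and let $n,k$ be integers with $1\le k\le n-2$; put $r:=n-2$. A *rope* in $\mathbb{P}^n=\mathbb{P}^n_K$ is a locally Cohen--Macaulay one-dimensional closed subscheme $C\subset\mathbb{P}^n$ whose support is a line $L$ and whose homogeneous (saturated) ideal satisfies $I_L^2\subset I_C$; an $(n-k)$-rope is a rope of degree $n-k$. Its genus $g$ is the arithmetic genus, so that the Hilbert polynomial of an $(n-k)$-rope of genus $g$ is $(n-k)z+1-g$. Its Rao function is $$\rho_C:\mathbb{Z}\to\mathbb{Z},\qquad \rho_C(z)=h^1(\mathbb{P}^n,\mathcal{I}_C(z))=\dim_K H^1(\mathbb{P}^n,\mathcal{I}_C(z)).$$ For $g\in\mathbb{Z}$ write $$-g=p_1(r+1-k)+s_1,\quad 0\le s_1\le r-k,\qquad\qquad -g=p_2k+s_2,\quad 0\le s_2<k,$$ with integers $p_1,s_1,p_2,s_2$, and set $$\alpha_{\min}=(\alpha_0,\dots,\alpha_{r-k})=(p_1,\dots,p_1,p_1+1,\dots,p_1+1),\qquad \beta_{\min}=(\beta_1,\dots,\beta_k)=(p_2,\dots,p_2,p_2+1,\dots,p_2+1),$$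 where $p_1+1$ occurs $s_1$ times and $p_2+1$ occurs $s_2$ times. With the convention $\binom{a}{1}:=0$ for integers $a<1$, define $$\rho_{\min}(z)=\sum_{i=0}^{r-k}\binom{z+\alpha_i}{1}+\sum_{j=1}^{k}\binom{z-\beta_j}{1}-(r+1)\binom{z}{1}\qquad(z\in\mathbb{Z}).$$ Then the Rao function of every $(n-k)$-rope $C\subset\mathbb{P}^n$ of genus $g$ satisfies $$\rho_C(z)\ge\rho_{\min}(z)\qquad\text{for all } z\in\mathbb{Z}.$$ -/

import Mathlib

noncomputable section

namespace Rope

open MvPolynomial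

attribute [local instance] MvPolynomial.gradedAlgebra

/-- The homogeneous coordinate ring `K[X_0, …, X_n]` of projective `n`-space. -/
abbrev CoordRing (K : Type*) [Field K] (n : ℕ) : Type _ := MvPolynomial (Fin (n + 1)) K

/-- The standard grading of the coordinate ring. -/
abbrev grading (K : Type*) [Field K] (n : ℕ) : ℕ → Submodule K (CoordRing K n) :=
  homogeneousSubmodule (Fin (n + 1)) K

/-! ### Closed subschemes of projective space

A closed subscheme `C` of `ℙⁿ` is represented by its homogeneous ideal `I_C`, i.e. by a
homogeneous ideal that is saturated with respect to the irrelevant ideal `(X_0, …, X_n)`. -/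

/-- `I` is saturated with respect to `(X_0, …, X_n)`. -/
def IsSaturated {K : Type*} [Field K] {n : ℕ} (I : Ideal (CoordRing K n)) : Prop :=
  ∀ f : CoordRing K n, (∀ i, ∃ m : ℕ, X i ^ m * f ∈ I) → f ∈ I

/-- A local ring is Cohen–Macaulay if its maximal ideal contains a regular sequence whose length
is the Krull dimension. In a local ring the maximal ideal consists of the nonunits. -/
def IsCohenMacaulayLocalRing (A : Type*) [CommRing A] : Prop :=
  IsLocalRing A ∧ ∃ rs : List A, (∀ r ∈ rs, r ∈ nonunits A) ∧
    RingTheory.Sequence.IsRegular A rs ∧ ((rs.length : ℕ) : WithBot ℕ∞) = ringKrullDim A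

/-- The stalk at the point `p` of the ideal sheaf of the subscheme defined by `I`, an ideal of the
local ring of `ℙⁿ` at `p` (the degree zero part of the localization at `p`). -/
def idealStalk {K : Type*} [Field K] {n : ℕ} (I : Ideal (CoordRing K n))
    (p : ProjectiveSpectrum (grading K n)) :
    Ideal (HomogeneousLocalization.AtPrime (grading K n) p.asHomogeneousIdeal.toIdeal) :=
  (I.map (algebraMap (CoordRing K n)
      (Localization.AtPrime p.asHomogeneousIdeal.toIdeal))).comap
    (algebraMap (HomogeneousLocalization.AtPrime (grading K n) p.asHomogeneousIdeal.toIdeal)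
      (Localization.AtPrime p.asHomogeneousIdeal.toIdeal))

/-- The subscheme defined by `I` is locally Cohen–Macaulay: all its local rings are. -/
def IsLocallyCohenMacaulay {K : Type*} [Field K] {n : ℕ} (I : Ideal (CoordRing K n)) : Prop :=
  ∀ p ∈ ProjectiveSpectrum.zeroLocus (grading K n) (I : Set (CoordRing K n)),
    IsCohenMacaulayLocalRing
      (HomogeneousLocalization.AtPrime (grading K n) p.asHomogeneousIdeal.toIdeal ⧸
        idealStalk I p)

/-- `J` is the homogeneous ideal of a line in `ℙⁿ`: it is generated by `n - 1` linearly
independent linear forms. -/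
def IsLineIdeal {K : Type*} [Field K] {n : ℕ} (J : Ideal (CoordRing K n)) : Prop :=
  ∃ l : Fin (n - 1) → CoordRing K n,
    (∀ i, (l i).IsHomogeneous 1) ∧ LinearIndependent K l ∧ J = Ideal.span (Set.range l)

/-- `I` is the homogeneous ideal of a rope: a locally Cohen–Macaulay closed subscheme of `ℙⁿ`
whose support is a line `L` (so it is one-dimensional) and whose ideal contains `I_L ^ 2`. -/
structure IsRope {K : Type*} [Field K] {n : ℕ} (I : Ideal (CoordRing K n)) : Prop where
  isHomogeneous : I.IsHomogeneous (grading K n)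
  isSaturated : IsSaturated I
  isLocallyCohenMacaulay : IsLocallyCohenMacaulay I
  supported_on_line : ∃ J : Ideal (CoordRing K n), IsLineIdeal J ∧
    ProjectiveSpectrum.zeroLocus (grading K n) (I : Set (CoordRing K n)) =
      ProjectiveSpectrum.zeroLocus (grading K n) (J : Set (CoordRing K n)) ∧
    J ^ 2 ≤ I

/-- The Hilbert function `z ↦ dim_K (R/I)_z`. -/
def hilbertFunction {K : Type*} [Field K] {n : ℕ} (I : Ideal (CoordRing K n)) (z : ℕ) : ℕ :=
  Module.finrank K
    (grading K n z ⧸ (I.restrictScalars K).comap (grading K n z).subtype)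

/-- The one-dimensional scheme defined by `I` has degree `d` and arithmetic genus `g`: its Hilbert
polynomial is `d z + 1 - g`. -/
def HasDegreeGenus {K : Type*} [Field K] {n : ℕ} (I : Ideal (CoordRing K n)) (d g : ℤ) : Prop :=
  ∀ᶠ z : ℕ in Filter.atTop, (hilbertFunction I z : ℤ) = d * z + 1 - g

/-! ### The Rao function

`H¹(ℙⁿ, 𝓘_C(z))` is computed by the Čech complex of the standard affine cover `D₊(X_i)`. All
modules of sections are realised inside the fraction field of the coordinate ring, in which they
embed compatibly with restriction because `I` is contained in a domain. -/

/-- The graded piece `R_w` of the coordinate ring for an integer `w`; it is zero if `w < 0`. -/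
def gradedPiece (K : Type*) [Field K] (n : ℕ) (w : ℤ) : Submodule K (CoordRing K n) :=
  if 0 ≤ w then grading K n w.toNat else ⊥

theorem mul_mem_gradedPiece {K : Type*} [Field K] {n : ℕ} {e : ℕ} {w w' : ℤ}
    {s f : CoordRing K n} (hs : s.IsHomogeneous e) (hf : f ∈ gradedPiece K n w)
    (hw : w' = e + w) : s * f ∈ gradedPiece K n w' := by
  subst hw
  unfold gradedPiece at *
  by_cases h : 0 ≤ w
  · rw [if_pos h] at hf
    rw [if_pos (by positivity), show ((e : ℤ) + w).toNat = e + w.toNat by omega]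
    exact hs.mul hf
  · rw [if_neg h, Submodule.mem_bot] at hf
    rw [hf, mul_zero]
    exact Submodule.zero_mem _

/-- The sections of `𝓘_C(z)` over `D₊(s)`, for `s ≠ 0` homogeneous of degree `e`: the degree `z`
part of the localization `I_s`, i.e. the fractions `f / s ^ m` with `f ∈ I` homogeneous of
degree `z + m e`. -/
def sections {K : Type*} [Field K] {n : ℕ} (I : Ideal (CoordRing K n)) (z : ℤ)
    (s : CoordRing K n) (e : ℕ) (hs : s.IsHomogeneous e) :
    Submodule K (FractionRing (CoordRing K n)) where
  carrier := {q | ∃ (m : ℕ) (f : CoordRing K n), f ∈ I ∧ f ∈ gradedPiece K n (z + m * e) ∧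
    algebraMap (CoordRing K n) (FractionRing (CoordRing K n)) (s ^ m) * q =
      algebraMap (CoordRing K n) (FractionRing (CoordRing K n)) f}
  zero_mem' := ⟨0, 0, I.zero_mem, Submodule.zero_mem _, by simp⟩
  add_mem' := by
    rintro a b ⟨m, f, hf, hfz, ha⟩ ⟨m', f', hf', hfz', hb⟩
    refine ⟨m + m', s ^ m' * f + s ^ m * f', I.add_mem (I.mul_mem_left _ hf)
      (I.mul_mem_left _ hf'), Submodule.add_mem _
        (mul_mem_gradedPiece (hs.pow m') hfz (by push_cast; ring))
        (mul_mem_gradedPiece (hs.pow m) hfz' (by push_cast; ring)), ?_⟩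
    rw [map_add, map_mul, map_mul, ← ha, ← hb, pow_add, map_mul]
    ring
  smul_mem' := by
    rintro c a ⟨m, f, hf, hfz, ha⟩
    refine ⟨m, c • f, ?_, Submodule.smul_mem _ c hfz, ?_⟩
    · rw [MvPolynomial.smul_eq_C_mul]
      exact I.mul_mem_left _ hf
    · rw [mul_smul_comm, ha, Algebra.algebraMap_eq_smul_one, Algebra.algebraMap_eq_smul_one,
        smul_assoc]

/-- The sections of `𝓘_C(z)` over `D₊(X_i)`. -/
def sectionsOne {K : Type*} [Field K] {n : ℕ} (I : Ideal (CoordRing K n)) (z : ℤ)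
    (i : Fin (n + 1)) : Submodule K (FractionRing (CoordRing K n)) :=
  sections I z (X i) 1 (isHomogeneous_X K i)

/-- The sections of `𝓘_C(z)` over `D₊(X_i) ∩ D₊(X_j) = D₊(X_i X_j)`. -/
def sectionsTwo {K : Type*} [Field K] {n : ℕ} (I : Ideal (CoordRing K n)) (z : ℤ)
    (i j : Fin (n + 1)) : Submodule K (FractionRing (CoordRing K n)) :=
  sections I z (X i * X j) (1 + 1) ((isHomogeneous_X K i).mul (isHomogeneous_X K j))

/-- Čech `1`-cocycles of `𝓘_C(z)`: families `c i j` of sections over `D₊(X_i X_j)` with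
`c i j + c j l = c i l` on triple intersections. -/
def cechCocycles {K : Type*} [Field K] {n : ℕ} (I : Ideal (CoordRing K n)) (z : ℤ) :
    Submodule K (Fin (n + 1) → Fin (n + 1) → FractionRing (CoordRing K n)) where
  carrier := {c | (∀ i j, c i j ∈ sectionsTwo I z i j) ∧ ∀ i j l, c i j + c j l = c i l}
  zero_mem' := ⟨fun _ _ => Submodule.zero_mem _, fun _ _ _ => by simp⟩
  add_mem' := by
    rintro a b ⟨ha, ha'⟩ ⟨hb, hb'⟩
    refine ⟨fun i j => Submodule.add_mem _ (ha i j) (hb i j), fun i j l => ?_⟩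
    simp only [Pi.add_apply, ← ha' i j l, ← hb' i j l]
    ring
  smul_mem' := by
    rintro r a ⟨ha, ha'⟩
    refine ⟨fun i j => Submodule.smul_mem _ r (ha i j), fun i j l => ?_⟩
    simp only [Pi.smul_apply, ← ha' i j l, smul_add]

/-- Čech `1`-coboundaries of `𝓘_C(z)`: families `b j - b i` with `b i` a section over
`D₊(X_i)`. -/
def cechCoboundaries {K : Type*} [Field K] {n : ℕ} (I : Ideal (CoordRing K n)) (z : ℤ) :
    Submodule K (Fin (n + 1) → Fin (n + 1) → FractionRing (CoordRing K n)) where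
  carrier := {c | ∃ b : Fin (n + 1) → FractionRing (CoordRing K n),
    (∀ i, b i ∈ sectionsOne I z i) ∧ ∀ i j, c i j = b j - b i}
  zero_mem' := ⟨0, fun _ => Submodule.zero_mem _, fun _ _ => by simp⟩
  add_mem' := by
    rintro a b ⟨u, hu, hu'⟩ ⟨v, hv, hv'⟩
    refine ⟨u + v, fun i => Submodule.add_mem _ (hu i) (hv i), fun i j => ?_⟩
    simp only [Pi.add_apply, hu' i j, hv' i j]
    ring
  smul_mem' := by
    rintro r a ⟨u, hu, hu'⟩
    refine ⟨r • u, fun i => Submodule.smul_mem _ r (hu i), fun i j => ?_⟩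
    simp only [Pi.smul_apply, hu' i j, smul_sub]

/-- Every coboundary is a cocycle. -/
theorem cechCoboundaries_le_cechCocycles {K : Type*} [Field K] {n : ℕ}
    (I : Ideal (CoordRing K n)) (z : ℤ) : cechCoboundaries I z ≤ cechCocycles I z := by
  have key : ∀ (s t : CoordRing K n) (hs : s.IsHomogeneous 1) (ht : t.IsHomogeneous 1)
      (hst : (s * t).IsHomogeneous (1 + 1)),
      sections I z s 1 hs ≤ sections I z (s * t) (1 + 1) hst := by
    rintro s t hs ht hst q ⟨m, f, hf, hfz, hq⟩
    refine ⟨m, t ^ m * f, I.mul_mem_left _ hf,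
      mul_mem_gradedPiece (ht.pow m) hfz (by push_cast; ring), ?_⟩
    rw [mul_pow, map_mul, map_mul, ← hq]
    ring
  rintro c ⟨b, hb, hc⟩
  refine ⟨fun i j => ?_, fun i j l => by rw [hc, hc, hc]; ring⟩
  rw [hc]
  refine Submodule.sub_mem _ ?_ ?_
  · have h := key (X j) (X i) (isHomogeneous_X K j) (isHomogeneous_X K i)
      ((isHomogeneous_X K j).mul (isHomogeneous_X K i)) (hb j)
    simpa only [sectionsTwo, mul_comm (X j : CoordRing K n) (X i)] using h
  · exact key (X i) (X j) (isHomogeneous_X K i) (isHomogeneous_X K j) _ (hb i)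

/-- The Čech cohomology `H¹(ℙⁿ, 𝓘_C(z))`. -/
abbrev H1 {K : Type*} [Field K] {n : ℕ} (I : Ideal (CoordRing K n)) (z : ℤ) : Type _ :=
  cechCocycles I z ⧸ (cechCoboundaries I z).submoduleOf (cechCocycles I z)

/-- The Rao function `ρ_C(z) = h¹(ℙⁿ, 𝓘_C(z))`. -/
def raoFunction {K : Type*} [Field K] {n : ℕ} (I : Ideal (CoordRing K n)) (z : ℤ) : ℕ :=
  Module.finrank K (H1 I z)

/-! ### The minimal Rao function -/

/-- Binomial coefficients with the convention `binom a b = 0` for integers `a < b`. -/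
def binom (a : ℤ) (b : ℕ) : ℤ := if a < b then 0 else (a.toNat.choose b : ℤ)

/-- The function `z ↦ ∑ i, binom (z + α i) 1 + ∑ j, binom (z - β j) 1 - (n - 1) binom z 1` attached
to a right type `α` of length `a` and a left type `β` of length `b`. -/
def raoOfTypes (n : ℕ) {a b : ℕ} (α : Fin a → ℤ) (β : Fin b → ℤ) (z : ℤ) : ℤ :=
  ∑ i, binom (z + α i) 1 + ∑ j, binom (z - β j) 1 - ((n : ℤ) - 1) * binom z 1

/-- The balanced sequence `(p, …, p, p + 1, …, p + 1)` of length `m`, where `N = p m + s` with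
`0 ≤ s < m` and `p + 1` occurs `s` times. -/
def balanced (m : ℕ) (N : ℤ) (i : Fin m) : ℤ :=
  if ((i : ℕ) : ℤ) < m - N % m then N / m else N / m + 1

/-- `α_min`, of length `n - 1 - k` and sum `-g`. -/
def alphaMin (n k : ℕ) (g : ℤ) : Fin (n - 1 - k) → ℤ := balanced (n - 1 - k) (-g)

/-- `β_min`, of length `k` and sum `-g`. -/
def betaMin (k : ℕ) (g : ℤ) : Fin k → ℤ := balanced k (-g)

/-- `ρ_min`, the function attached to the types `α_min` and `β_min`. -/
def raoMin (n k : ℕ) (g : ℤ) (z : ℤ) : ℤ := raoOfTypes n (alphaMin n k g) (betaMin k g) z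

end Rope

end

/-! Let `J` be the ideal of the line L, S = K[X_0, X_1] its coordinate ring, E = 𝓘_L/𝓘_C, and h(w) =
dim (J/I)_w. Since J² ⊆ I, the quotient J/I is an S-module generated by the n-1 linear forms cutting
out L; let N be the kernel of S(-1)^(n-1) → J/I. Then h(z) + dim N_z = (n-1) max(z, 0), and h(w) =
(n-1-k)w - g for large w.

Because H¹(𝓘_L(z)) = 0, the Rao function ρ(z) is the dimension of H⁰(E(z)) modulo (J/I)_z. The
theorem then rests on two Riemann–Roch inequalities h⁰ ≥ χ on L: one for E, giving ρ(z) + h(z) ≥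
(n-1-k)z - g, and one for the bundle of N, giving dim N_z ≥ kz + g. As ρ, h and dim N are
nonnegative, ρ(z) ≥ max((n-1-k)z - g, 0) - h(z), where -h(z) ≥ max(kz + g, 0) - (n-1) max(z, 0).
Balancedness of the minimal types makes `raoMin` exactly the sum of these bounds (`raoMin_eq`).

Both inequalities are proved by counting dimensions. Local Cohen–Macaulayness and saturation make
two variables X p, X q that are coordinates on L nonzerodivisors modulo `I` (`mem_of_X_mul_mem`).
Koszul exactness for their powers (`finrank_map_sup_map`) bounds second differences: ρ(z) ≥ 2h(z+m)
- h(z) - h(z+2m) (`le_finrank_inf_span2`, `finrank_inf_span2_le`), and dim N is convex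
(`finrank_relPiece_convex`). For large m the terms at z+m and z+2m are known, and m cancels. -/

noncomputable section

namespace Rope

open MvPolynomial

attribute [local instance] MvPolynomial.gradedAlgebra

/-! ### Graded pieces in integer degrees and Hilbert functions. -/

section GradedPieces

variable {K : Type*} [Field K] {n : ℕ}

/-- The homogeneous component of integer degree `w`. -/
def comp (w : ℤ) : CoordRing K n →ₗ[K] CoordRing K n :=
  if 0 ≤ w then homogeneousComponent w.toNat else 0

theorem comp_natCast (w : ℕ) (f : CoordRing K n) :
    comp (w : ℤ) f = homogeneousComponent w f := by
  simp [comp]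

theorem mem_gradedPiece_natCast {w : ℕ} {f : CoordRing K n} :
    f ∈ gradedPiece K n (w : ℤ) ↔ f.IsHomogeneous w := by
  simp [gradedPiece, mem_homogeneousSubmodule]

theorem gradedPiece_of_neg {w : ℤ} (hw : w < 0) : gradedPiece K n w = ⊥ := by
  simp [gradedPiece, not_le.2 hw]

theorem comp_mem_gradedPiece (w : ℤ) (f : CoordRing K n) : comp w f ∈ gradedPiece K n w := by
  unfold comp gradedPiece
  split_ifs
  · exact homogeneousComponent_mem _ _
  · simp

theorem comp_eq_self {w : ℤ} {f : CoordRing K n} (hf : f ∈ gradedPiece K n w) :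
    comp w f = f := by
  unfold comp
  unfold gradedPiece at hf
  split_ifs at hf ⊢ with h
  · exact homogeneousComponent_eq_self hf
  · simp_all

theorem coe_decompose_grading (f : CoordRing K n) (m : ℕ) :
    (DirectSum.decompose (homogeneousSubmodule (Fin (n + 1)) K) f m : CoordRing K n) =
      homogeneousComponent m f :=
  decomposition.decompose'_apply f m

theorem comp_mul {s : CoordRing K n} {e : ℕ} (hs : s.IsHomogeneous e) {w w' : ℤ}
    (hw : w' = e + w) (f : CoordRing K n) : comp w' (s * f) = s * comp w f := by
  subst hw
  have key : ∀ m : ℕ, homogeneousComponent m (s * f) =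
      if e ≤ m then s * homogeneousComponent (m - e) f else 0 := by
    intro m
    have h := DirectSum.coe_decompose_mul_of_left_mem (𝒜 := homogeneousSubmodule (Fin (n + 1)) K)
      (b := f) m ((mem_homogeneousSubmodule e s).2 hs)
    simp_rw [coe_decompose_grading] at h
    exact h
  unfold comp
  by_cases h : 0 ≤ w
  · rw [if_pos h, if_pos (by positivity), key, if_pos (by omega)]
    congr 3
    omega
  · rw [if_neg h]
    split_ifs with h'
    · rw [key, if_neg (by omega)]
      simp
    · simp

theorem comp_mem_ideal {I : Ideal (CoordRing K n)} (hI : I.IsHomogeneous (grading K n))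
    {f : CoordRing K n} (hf : f ∈ I) (w : ℤ) : comp w f ∈ I := by
  unfold comp
  split_ifs
  · exact homogeneousComponent_mem_of_mem hI hf _
  · simp

theorem mem_ideal_of_comp {I : Ideal (CoordRing K n)} {f : CoordRing K n}
    (hf : ∀ w : ℕ, homogeneousComponent w f ∈ I) : f ∈ I := by
  rw [← sum_homogeneousComponent f]
  exact I.sum_mem fun i _ => hf i

theorem mem_gradedPiece_of_mul {s : CoordRing K n} {e : ℕ} (hs : s.IsHomogeneous e) (h0 : s ≠ 0)
    {w w' : ℤ} (hw : w' = e + w) {f : CoordRing K n} (hf : s * f ∈ gradedPiece K n w') :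
    f ∈ gradedPiece K n w := by
  have h : s * comp w f = s * f := by rw [← comp_mul hs hw, comp_eq_self hf]
  rw [← mul_left_cancel₀ h0 h]
  exact comp_mem_gradedPiece w f

instance finiteDimensional_gradedPiece (w : ℤ) : FiniteDimensional K (gradedPiece K n w) := by
  by_cases h : 0 ≤ w
  · rw [gradedPiece, if_pos h]
    exact Module.Finite.iff_fg.2 (homogeneousSubmodule_fg _ _ _)
  · rw [gradedPiece, if_neg h]
    infer_instance

theorem finrank_gradedPiece_one (w : ℤ) :
    (Module.finrank K (gradedPiece K 1 w) : ℤ) = max (w + 1) 0 := by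
  by_cases h : 0 ≤ w
  · obtain ⟨m, rfl⟩ := Int.eq_ofNat_of_zero_le h
    have : gradedPiece K 1 (m : ℤ) =
        AddMonoidAlgebra.supported K K {d : Fin 2 →₀ ℕ | d.degree = m} := by
      rw [← homogeneousSubmodule_eq_finsupp_supported]
      simp [gradedPiece]
    rw [this, (AddMonoidAlgebra.supportedEquivFinsupp _).finrank_eq]
    have e : {d : Fin 2 →₀ ℕ | d.degree = m} ≃ Fin (m + 1) :=
      { toFun := fun d => ⟨d.1 0, by
          have := d.2
          simp only [Set.mem_ofPred_eq, Finsupp.degree_eq_sum, Fin.sum_univ_two] at this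
          omega⟩
        invFun := fun i => ⟨Finsupp.equivFunOnFinite.symm ![i, m - i], by
          have := i.2
          simp [Finsupp.degree_eq_sum, Fin.sum_univ_two]
          omega⟩
        left_inv := fun d => by
          have := d.2
          simp only [Set.mem_ofPred_eq, Finsupp.degree_eq_sum, Fin.sum_univ_two] at this
          ext i
          fin_cases i <;> simp
          omega
        right_inv := fun i => by simp }
    have : Fintype {d : Fin 2 →₀ ℕ | d.degree = m} := Fintype.ofEquiv _ e.symm
    rw [Module.finrank_finsupp_self, Fintype.card_congr e]
    simp
    omega
  · rw [gradedPiece_of_neg (not_le.1 h), finrank_bot]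
    push_cast
    omega

/-- The degree `w` part of an ideal. -/
def piece (I : Ideal (CoordRing K n)) (w : ℤ) : Submodule K (CoordRing K n) :=
  gradedPiece K n w ⊓ I.restrictScalars K

theorem mem_piece {I : Ideal (CoordRing K n)} {w : ℤ} {f : CoordRing K n} :
    f ∈ piece I w ↔ f ∈ gradedPiece K n w ∧ f ∈ I := Iff.rfl

theorem piece_mono {I J : Ideal (CoordRing K n)} (h : I ≤ J) (w : ℤ) : piece I w ≤ piece J w :=
  fun _ hf => ⟨hf.1, h hf.2⟩

instance finiteDimensional_piece (I : Ideal (CoordRing K n)) (w : ℤ) :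
    FiniteDimensional K (piece I w) :=
  Submodule.finiteDimensional_of_le (inf_le_left : piece I w ≤ gradedPiece K n w)

theorem mul_mem_piece {I : Ideal (CoordRing K n)} {e : ℕ} {w w' : ℤ} {s f : CoordRing K n}
    (hs : s.IsHomogeneous e) (hf : f ∈ piece I w) (hw : w' = e + w) : s * f ∈ piece I w' :=
  ⟨mul_mem_gradedPiece hs hf.1 hw, I.mul_mem_left _ hf.2⟩

/-- Multiplication by `s`, as a `K`-linear map. -/
abbrev mulL (s : CoordRing K n) : CoordRing K n →ₗ[K] CoordRing K n := LinearMap.mulLeft K s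

theorem hilbertFunction_add (I : Ideal (CoordRing K n)) (z : ℕ) :
    hilbertFunction I z + Module.finrank K (piece I z) = Module.finrank K (gradedPiece K n z) := by
  have e : gradedPiece K n (z : ℤ) = grading K n z := by simp [gradedPiece]
  have hf : FiniteDimensional K (grading K n z) := e ▸ finiteDimensional_gradedPiece (z : ℤ)
  unfold hilbertFunction piece
  rw [e, ← Submodule.finrank_quotient_add_finrank
    ((I.restrictScalars K).comap (grading K n z).subtype)]
  congr 1
  rw [← Submodule.map_comap_subtype]
  exact ((Submodule.equivMapOfInjective _ (Submodule.injective_subtype _) _).finrank_eq).symm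

end GradedPieces

/-! ### Closed form of the minimal Rao function. -/

section Balanced

theorem binom_one (a : ℤ) : binom a 1 = max a 0 := by
  unfold binom
  split_ifs with h
  · push_cast at h
    omega
  · push_cast at h
    rw [Nat.choose_one_right]
    omega

theorem sum_balanced {m : ℕ} (hm : 0 < m) (N : ℤ) : ∑ i, balanced m N i = N := by
  have h1 : 0 ≤ N % m := Int.emod_nonneg _ (by omega)
  have h2 : N % m < m := Int.emod_lt_of_pos _ (by omega)
  obtain ⟨r, hr⟩ := Int.eq_ofNat_of_zero_le h1
  have key : ∀ i : Fin m, balanced m N i = N / m + if m - r ≤ (i : ℕ) then 1 else 0 := by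
    intro i
    unfold balanced
    rw [hr]
    have := i.2
    split_ifs <;> omega
  simp_rw [key]
  rw [Finset.sum_add_distrib, Finset.sum_const, Finset.card_univ, Fintype.card_fin,
    Fin.sum_univ_eq_sum_range (fun i => if m - r ≤ i then (1 : ℤ) else 0), Finset.sum_ite,
    Finset.sum_const_zero, add_zero, Finset.sum_const]
  have : (Finset.range m).filter (fun i => m - r ≤ i) = Finset.Ico (m - r) m := by
    ext i
    simp
    omega
  rw [this, Nat.card_Ico, nsmul_eq_mul, nsmul_eq_mul, mul_one,
    show ((m - (m - r) : ℕ) : ℤ) = N % m by omega]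
  exact Int.mul_ediv_add_emod N m

theorem balanced_eq_or (m : ℕ) (N : ℤ) (i : Fin m) :
    balanced m N i = N / m ∨ balanced m N i = N / m + 1 := by
  unfold balanced
  split_ifs <;> simp

/-- The entries take only two consecutive integer values, so the summands are all nonnegative or all
nonpositive, and the positive part commutes with the sum. -/
theorem sum_max_balanced_add {m : ℕ} (hm : 0 < m) (N z : ℤ) :
    ∑ i, max (z + balanced m N i) 0 = max (m * z + N) 0 := by
  have hs : ∑ i, (z + balanced m N i) = m * z + N := by
    rw [Finset.sum_add_distrib, sum_balanced hm]
    simp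
  rw [← hs]
  by_cases h : 0 ≤ z + N / m
  · have h' : ∀ i ∈ Finset.univ, 0 ≤ z + balanced m N i := fun i _ => by
      rcases balanced_eq_or m N i with h | h <;> omega
    rw [max_eq_left (Finset.sum_nonneg h')]
    exact Finset.sum_congr rfl fun i hi => max_eq_left (h' i hi)
  · have h' : ∀ i ∈ Finset.univ, z + balanced m N i ≤ 0 := fun i _ => by
      rcases balanced_eq_or m N i with h | h <;> omega
    rw [max_eq_right (Finset.sum_nonpos h')]
    exact Finset.sum_eq_zero fun i hi => max_eq_right (h' i hi)

theorem sum_max_sub_balanced {m : ℕ} (hm : 0 < m) (N z : ℤ) :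
    ∑ i, max (z - balanced m N i) 0 = max (m * z - N) 0 := by
  have hs : ∑ i, (z - balanced m N i) = m * z - N := by
    rw [Finset.sum_sub_distrib, sum_balanced hm]
    simp
  rw [← hs]
  by_cases h : 0 < z - N / m
  · have h' : ∀ i ∈ Finset.univ, 0 ≤ z - balanced m N i := fun i _ => by
      rcases balanced_eq_or m N i with h | h <;> omega
    rw [max_eq_left (Finset.sum_nonneg h')]
    exact Finset.sum_congr rfl fun i hi => max_eq_left (h' i hi)
  · have h' : ∀ i ∈ Finset.univ, z - balanced m N i ≤ 0 := fun i _ => by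
      rcases balanced_eq_or m N i with h | h <;> omega
    rw [max_eq_right (Finset.sum_nonpos h')]
    exact Finset.sum_eq_zero fun i hi => max_eq_right (h' i hi)

theorem raoMin_eq {n k : ℕ} (hk : 1 ≤ k) (hkn : k + 2 ≤ n) (g z : ℤ) :
    raoMin n k g z = max (((n : ℤ) - 1 - k) * z - g) 0 + max (k * z + g) 0
      - ((n : ℤ) - 1) * max z 0 := by
  unfold raoMin raoOfTypes alphaMin betaMin
  simp_rw [binom_one]
  rw [sum_max_balanced_add (by omega), sum_max_sub_balanced (by omega),
    show ((n - 1 - k : ℕ) : ℤ) = (n : ℤ) - 1 - k by omega]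
  congr 3
  all_goals ring

end Balanced

/-! ### Coordinates on the line. -/

/-- Coordinates adapted to the line with ideal `J`: linear forms `l` generating `J`, and two
variables `X p`, `X q` whose restrictions to the line are homogeneous coordinates on it; the
variable `X j` restricts to `lam j * X p + mu j * X q`. -/
structure LineCoords {K : Type*} [Field K] {n : ℕ} (J : Ideal (CoordRing K n)) where
  l : Fin (n - 1) → CoordRing K n
  l_hom : ∀ i, (l i).IsHomogeneous 1
  span_l : J = Ideal.span (Set.range l)
  p : Fin (n + 1)
  q : Fin (n + 1)
  lam : Fin (n + 1) → K
  mu : Fin (n + 1) → K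
  lam_p : lam p = 1
  mu_p : mu p = 0
  lam_q : lam q = 0
  mu_q : mu q = 1
  X_sub_mem : ∀ j, X j - (C (lam j) * X p + C (mu j) * X q) ∈ J
  aeval_l : ∀ i, aeval (fun j => (C (lam j) * X 0 + C (mu j) * X 1 : CoordRing K 1)) (l i) = 0

section Existence

variable {K : Type*} [Field K] {n : ℕ}

/-- The linear form with given coefficients. -/
def linearForm (K : Type*) [Field K] (n : ℕ) : (Fin (n + 1) → K) →ₗ[K] CoordRing K n :=
  ∑ j, (LinearMap.proj j).smulRight (X j)

theorem linearForm_apply (v : Fin (n + 1) → K) : linearForm K n v = ∑ j, v j • X j := by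
  simp [linearForm]

theorem linearForm_single (j : Fin (n + 1)) : linearForm K n (Pi.single j 1) = X j := by
  rw [linearForm_apply, Finset.sum_eq_single j]
  · simp
  · intro i _ hi
    simp [hi]
  · simp

theorem exists_linearForm_eq {f : CoordRing K n} (hf : f.IsHomogeneous 1) :
    ∃ v, linearForm K n v = f := by
  have h : f ∈ Submodule.span K (Set.range (X : Fin (n + 1) → CoordRing K n)) := by
    rw [← homogeneousSubmodule_one_eq_span_X]
    exact hf
  obtain ⟨c, hc⟩ := (Submodule.mem_span_range_iff_exists_fun K).1 h
  exact ⟨c, by rw [linearForm_apply, hc]⟩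

/-- The space of linear forms modulo those vanishing on the line is two-dimensional and spanned by
the classes of the variables, so two variables form a basis. Using variables rather than general
linear forms keeps the standard Čech cover usable. -/
theorem exists_lineCoords (hn : 1 ≤ n) {J : Ideal (CoordRing K n)} (hJ : IsLineIdeal J) :
    Nonempty (LineCoords J) := by
  obtain ⟨l, hl, hli, rfl⟩ := hJ
  choose v hv using fun i => exists_linearForm_eq (hl i)
  have hvi : LinearIndependent K v := by
    apply LinearIndependent.of_comp (linearForm K n)
    convert hli using 1
    exact funext hv
  set W := Submodule.span K (Set.range v) with hW
  have hWd : Module.finrank K W = n - 1 := by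
    rw [hW, finrank_span_eq_card hvi, Fintype.card_fin]
  have hQ : Module.finrank K ((Fin (n + 1) → K) ⧸ W) = 2 := by
    have := W.finrank_quotient_add_finrank
    rw [hWd, Module.finrank_fin_fun] at this
    omega
  let e : Fin (n + 1) → (Fin (n + 1) → K) ⧸ W := fun j => W.mkQ (Pi.single j 1)
  have he : ⊤ ≤ Submodule.span K (Set.range e) := by
    have h1 : Set.range e = W.mkQ '' Set.range (fun j => (Pi.single j 1 : Fin (n + 1) → K)) := by
      rw [← Set.range_comp]
      rfl
    rw [h1, ← Submodule.map_span]
    have h2 := (Pi.basisFun K (Fin (n + 1))).span_eq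
    have h3 : (⇑(Pi.basisFun K (Fin (n + 1)))) = fun j => Pi.single j 1 := by
      ext j
      simp
    rw [h3] at h2
    rw [h2, Submodule.map_top, Submodule.range_mkQ]
  obtain ⟨κ, a, ha, hsp, hli'⟩ := exists_linearIndependent' K e
  let b := Module.Basis.mk hli' (by rw [hsp]; exact he)
  have : Fintype κ := FiniteDimensional.fintypeBasisIndex b
  have hκ : Fintype.card κ = 2 := by rw [← hQ, Module.finrank_eq_card_basis b]
  let b' := b.reindex (Fintype.equivFinOfCardEq hκ)
  let p := a ((Fintype.equivFinOfCardEq hκ).symm 0)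
  let q := a ((Fintype.equivFinOfCardEq hκ).symm 1)
  have hp : b' 0 = e p := by simp [b', b, p]
  have hq : b' 1 = e q := by simp [b', b, q]
  have key : ∀ u, u - (b'.repr (W.mkQ u) 0 • Pi.single p 1 + b'.repr (W.mkQ u) 1 • Pi.single q 1)
      ∈ W := by
    intro u
    rw [← Submodule.Quotient.mk_eq_zero W, ← Submodule.mkQ_apply, map_sub, map_add, map_smul,
      map_smul]
    change _ - (_ • e p + _ • e q) = 0
    rw [← hp, ← hq, sub_eq_zero]
    conv_lhs => rw [← b'.sum_repr (W.mkQ u), Fin.sum_univ_two]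
  refine ⟨⟨l, hl, rfl, p, q, fun j => b'.repr (e j) 0, fun j => b'.repr (e j) 1, ?_, ?_, ?_, ?_,
    ?_, ?_⟩⟩
  · simp [← hp]
  · simp [← hp]
  · simp [← hq]
  · simp [← hq]
  · intro j
    have h1 := Submodule.mem_map_of_mem (f := linearForm K n) (key (Pi.single j 1))
    rw [map_sub, map_add, map_smul, map_smul, linearForm_single, linearForm_single,
      linearForm_single] at h1
    have h2 : W.map (linearForm K n) = Submodule.span K (Set.range l) := by
      rw [hW, Submodule.map_span, ← Set.range_comp]
      congr 2
      exact funext hv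
    rw [h2] at h1
    rw [C_mul', C_mul']
    exact Submodule.span_le_restrictScalars K (CoordRing K n) _ h1
  · intro i
    have h1 : ∀ u, aeval (fun j => (C (b'.repr (e j) 0) * X 0 + C (b'.repr (e j) 1) * X 1 :
        CoordRing K 1)) (linearForm K n u) =
        b'.repr (W.mkQ u) 0 • X 0 + b'.repr (W.mkQ u) 1 • X 1 := by
      intro u
      have h2 : W.mkQ u = ∑ j, u j • e j := by
        conv_lhs => rw [pi_eq_sum_univ' u]
        simp only [map_sum, map_smul, e]
      rw [linearForm_apply, h2]
      simp only [map_sum, map_smul, aeval_X, C_mul', Finsupp.coe_finsetSum, Finset.sum_apply,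
        Finsupp.smul_apply, smul_add, Finset.sum_add_distrib, Finset.sum_smul, smul_assoc]
    rw [← hv i, h1]
    have h3 : W.mkQ (v i) = 0 := by
      rw [Submodule.mkQ_apply, Submodule.Quotient.mk_eq_zero]
      exact Submodule.subset_span ⟨i, rfl⟩
    simp [h3]

end Existence

namespace LineCoords

variable {K : Type*} [Field K] {n : ℕ} {J : Ideal (CoordRing K n)} (c : LineCoords J)

/-- Exchange the two coordinates on the line. -/
def swap : LineCoords J where
  l := c.l
  l_hom := c.l_hom
  span_l := c.span_l
  p := c.q
  q := c.p
  lam := c.mu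
  mu := c.lam
  lam_p := c.mu_q
  mu_p := c.lam_q
  lam_q := c.mu_p
  mu_q := c.lam_p
  X_sub_mem j := by
    rw [add_comm (C (c.mu j) * X c.q)]
    exact c.X_sub_mem j
  aeval_l i := by
    have h := congrArg (aeval (fun j : Fin 2 => (X (Equiv.swap 0 1 j) : CoordRing K 1)))
      (c.aeval_l i)
    rw [map_zero, ← AlgHom.comp_apply, comp_aeval] at h
    rw [← h]
    congr 2
    ext1 j
    simp [algebraMap_eq]
    ring

/-- Restriction of forms to the line. -/
def res : CoordRing K n →ₐ[K] CoordRing K 1 :=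
  aeval fun j => C (c.lam j) * X 0 + C (c.mu j) * X 1

/-- Extension of forms from the line, as forms in the two coordinate variables. -/
def ext : CoordRing K 1 →ₐ[K] CoordRing K n :=
  aeval ![X c.p, X c.q]

@[simp] theorem ext_X_zero : c.ext (X 0) = X c.p := by simp [ext]

@[simp] theorem ext_X_one : c.ext (X 1) = X c.q := by simp [ext]

@[simp] theorem res_X_p : c.res (X c.p) = X 0 := by simp [res, c.lam_p, c.mu_p]

@[simp] theorem res_X_q : c.res (X c.q) = X 1 := by simp [res, c.lam_q, c.mu_q]

@[simp] theorem res_ext (f : CoordRing K 1) : c.res (c.ext f) = f := by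
  have : c.res.comp c.ext = AlgHom.id K _ := by
    apply algHom_ext
    intro i
    fin_cases i
    · simp [ext]
    · simp [ext]
  exact DFunLike.congr_fun this f

theorem sub_ext_res_mem (f : CoordRing K n) : f - c.ext (c.res f) ∈ J := by
  have : (Ideal.Quotient.mkₐ K J) = ((Ideal.Quotient.mkₐ K J).comp c.ext).comp c.res := by
    apply algHom_ext
    intro j
    simp only [AlgHom.comp_apply, Ideal.Quotient.mkₐ_eq_mk]
    rw [Ideal.Quotient.eq]
    have h : c.ext (c.res (X j)) = C (c.lam j) * X c.p + C (c.mu j) * X c.q := by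
      simp only [res, aeval_X, map_add, map_mul, ext_X_zero, ext_X_one]
      simp only [← algebraMap_eq, AlgHom.commutes]
    rw [h]
    exact c.X_sub_mem j
  exact Ideal.Quotient.eq.1 (DFunLike.congr_fun this f)

/-- Thus R/J is the polynomial ring in two variables, with `ext` splitting the restriction. -/
theorem res_eq_zero {f : CoordRing K n} : c.res f = 0 ↔ f ∈ J := by
  refine ⟨fun h => ?_, fun h => ?_⟩
  · have := c.sub_ext_res_mem f
    rwa [h, map_zero, sub_zero] at this
  · rw [← RingHom.mem_ker]
    have : J ≤ RingHom.ker c.res := by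
      conv_lhs => rw [c.span_l]
      rw [Ideal.span_le]
      rintro _ ⟨i, rfl⟩
      exact c.aeval_l i
    exact this h

theorem isPrime (c : LineCoords J) : J.IsPrime := by
  have : J = RingHom.ker c.res := by
    ext f
    rw [RingHom.mem_ker, c.res_eq_zero]
  rw [this]
  exact RingHom.ker_isPrime c.res

theorem X_p_notMem : X c.p ∉ J := by
  rw [← c.res_eq_zero, res_X_p]
  exact X_ne_zero _

theorem isHomogeneous (c : LineCoords J) : J.IsHomogeneous (grading K n) := by
  rw [c.span_l]
  apply Ideal.homogeneous_span
  rintro _ ⟨i, rfl⟩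
  exact ⟨1, c.l_hom i⟩

theorem p_ne_q : c.p ≠ c.q := by
  intro h
  have := c.lam_q
  rw [← h, c.lam_p] at this
  exact one_ne_zero this

theorem res_mem_gradedPiece {w : ℤ} {f : CoordRing K n} (hf : f ∈ gradedPiece K n w) :
    c.res f ∈ gradedPiece K 1 w := by
  unfold gradedPiece at *
  split_ifs at hf ⊢ with h
  · have := IsHomogeneous.aeval (m := w.toNat) (n := 1) hf
      (fun j => (C (c.lam j) * X 0 + C (c.mu j) * X 1 : CoordRing K 1))
      (fun j => (isHomogeneous_C_mul_X _ _).add (isHomogeneous_C_mul_X _ _))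
    rwa [one_mul] at this
  · rw [Submodule.mem_bot] at hf
    rw [hf, map_zero]
    exact Submodule.zero_mem _

theorem ext_mem_gradedPiece {w : ℤ} {f : CoordRing K 1} (hf : f ∈ gradedPiece K 1 w) :
    c.ext f ∈ gradedPiece K n w := by
  unfold gradedPiece at *
  split_ifs at hf ⊢ with h
  · have := IsHomogeneous.aeval (m := w.toNat) (n := 1) hf ![X c.p, X c.q]
      (fun j => by fin_cases j <;> exact isHomogeneous_X K _)
    rwa [one_mul] at this
  · rw [Submodule.mem_bot] at hf
    rw [hf, map_zero]
    exact Submodule.zero_mem _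

/-- The line has Hilbert function `z + 1`. -/
theorem finrank_piece (c : LineCoords J) (z : ℤ) :
    (Module.finrank K (gradedPiece K n z) : ℤ) =
      Module.finrank K (piece J z) + max (z + 1) 0 := by
  rw [← finrank_gradedPiece_one (K := K)]
  have h := LinearMap.finrank_range_add_finrank_ker
    (c.res.toLinearMap.comp (gradedPiece K n z).subtype)
  have h1 : LinearMap.range (c.res.toLinearMap.comp (gradedPiece K n z).subtype) =
      gradedPiece K 1 z := by
    ext f
    constructor
    · rintro ⟨g, rfl⟩
      exact c.res_mem_gradedPiece g.2
    · intro hf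
      exact ⟨⟨c.ext f, c.ext_mem_gradedPiece hf⟩, c.res_ext f⟩
  have h2 : LinearMap.ker (c.res.toLinearMap.comp (gradedPiece K n z).subtype) =
      (J.restrictScalars K).comap (gradedPiece K n z).subtype := by
    ext f
    exact c.res_eq_zero
  have h3 : Module.finrank K ((J.restrictScalars K).comap (gradedPiece K n z).subtype) =
      Module.finrank K (piece J z) := by
    rw [piece, ← Submodule.map_comap_subtype]
    exact (Submodule.equivMapOfInjective _ (Submodule.injective_subtype _) _).finrank_eq
  rw [h1, h2, h3] at h
  omega

end LineCoords

/-! ### Germs at a point of a locally Cohen–Macaulay scheme. -/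

section Stalks

variable {K : Type*} [Field K] {n : ℕ}

theorem mk_mem_idealStalk_iff {I : Ideal (CoordRing K n)}
    {p : ProjectiveSpectrum (grading K n)}
    (x : HomogeneousLocalization.NumDenSameDeg (grading K n)
      p.asHomogeneousIdeal.toIdeal.primeCompl) :
    HomogeneousLocalization.mk x ∈ idealStalk I p ↔
      ∃ u ∉ p.asHomogeneousIdeal.toIdeal, u * (x.num : CoordRing K n) ∈ I := by
  rw [idealStalk, Ideal.mem_comap, HomogeneousLocalization.algebraMap_apply,
    HomogeneousLocalization.val_mk, Localization.mk_eq_mk',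
    IsLocalization.mk'_mem_map_algebraMap_iff p.asHomogeneousIdeal.toIdeal.primeCompl]
  rfl

/-- A local section of the structure sheaf of a locally Cohen–Macaulay scheme that is killed by
the ideal of a point `p` has zero germ at `p`, if some `s` in that ideal is not nilpotent at `p`. -/
theorem exists_mul_mem_of_isCohenMacaulayLocalRing {I : Ideal (CoordRing K n)}
    {p : ProjectiveSpectrum (grading K n)}
    (hCM : IsCohenMacaulayLocalRing
      (HomogeneousLocalization.AtPrime (grading K n) p.asHomogeneousIdeal.toIdeal ⧸
        idealStalk I p))
    {s t f : CoordRing K n} {e d : ℕ} (hs : s.IsHomogeneous e) (ht : t.IsHomogeneous e)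
    (hf : f.IsHomogeneous (d * e)) (hsp : s ∈ p.asHomogeneousIdeal.toIdeal)
    (htp : t ∉ p.asHomogeneousIdeal.toIdeal)
    (hfI : ∀ u ∈ p.asHomogeneousIdeal.toIdeal, u * f ∈ I)
    (hsn : ∀ u ∉ p.asHomogeneousIdeal.toIdeal, ∀ m : ℕ, u * s ^ m ∉ I) :
    ∃ u ∉ p.asHomogeneousIdeal.toIdeal, u * f ∈ I := by
  set P := p.asHomogeneousIdeal.toIdeal with hP
  have h1P : (1 : CoordRing K n) ∉ P := fun h => p.isPrime.ne_top ((Ideal.eq_top_iff_one _).2 h)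
  -- Dividing by powers of `t` turns `f` and `s` into the degree zero germs `F` and `σ`.
  let F : HomogeneousLocalization.NumDenSameDeg (grading K n) P.primeCompl :=
    ⟨d * e, ⟨f, hf⟩, ⟨t ^ d, by rw [mul_comm]; exact ht.pow d⟩,
      fun h => htp (p.isPrime.mem_of_pow_mem d h)⟩
  let σ : HomogeneousLocalization.NumDenSameDeg (grading K n) P.primeCompl :=
    ⟨e, ⟨s, hs⟩, ⟨t, ht⟩, htp⟩
  by_contra hcon
  have hF : Ideal.Quotient.mk (idealStalk I p) (HomogeneousLocalization.mk F) ≠ 0 := by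
    rw [Ne, Ideal.Quotient.eq_zero_iff_mem, mk_mem_idealStalk_iff]
    exact hcon
  obtain ⟨hloc, rs, hrs, hreg, hlen⟩ := hCM
  have hkill : ∀ x : HomogeneousLocalization.NumDenSameDeg (grading K n) P.primeCompl,
      (x.num : CoordRing K n) ∈ P →
      Ideal.Quotient.mk (idealStalk I p) (HomogeneousLocalization.mk x) *
        Ideal.Quotient.mk (idealStalk I p) (HomogeneousLocalization.mk F) = 0 := by
    intro x hx
    rw [← map_mul, ← HomogeneousLocalization.mk_mul, Ideal.Quotient.eq_zero_iff_mem,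
      mk_mem_idealStalk_iff]
    refine ⟨1, h1P, ?_⟩
    rw [one_mul, HomogeneousLocalization.NumDenSameDeg.num_mul]
    exact hfI _ hx
  -- If the regular sequence is empty, the local ring has dimension 0 and the nonunit `σ` is
  -- nilpotent, against `hsn`. Otherwise its first entry is a nonzerodivisor in the maximal ideal,
  -- yet that ideal kills the nonzero germ `F`.
  cases rs with
  | nil =>
    have hdim : Ring.KrullDimLE 0 (HomogeneousLocalization.AtPrime (grading K n) P ⧸
        idealStalk I p) := by
      rw [ringKrullDimZero_iff_ringKrullDim_eq_zero, ← hlen]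
      simp
    have hnil : ∀ x : HomogeneousLocalization.AtPrime (grading K n) P ⧸ idealStalk I p,
        IsNilpotent x ↔ ¬ IsUnit x :=
      ((Ring.krullDimLE_zero_and_isLocalRing_tfae _).out 0 2 rfl rfl).1 (And.intro hdim hloc)
    obtain ⟨m, hm⟩ := (hnil (Ideal.Quotient.mk (idealStalk I p)
      (HomogeneousLocalization.mk σ))).2 fun hunit =>
        hF ((hunit.mul_right_eq_zero).1 (hkill σ hsp))
    rw [← map_pow, ← HomogeneousLocalization.mk_pow, Ideal.Quotient.eq_zero_iff_mem,
      mk_mem_idealStalk_iff] at hm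
    obtain ⟨u, hu, hum⟩ := hm
    exact hsn u hu m hum
  | cons r rs =>
    have hr := ((RingTheory.Sequence.isWeaklyRegular_cons_iff _ _ _).1 hreg.toIsWeaklyRegular).1
    obtain ⟨x, rfl⟩ := Ideal.Quotient.mk_surjective r
    obtain ⟨x, rfl⟩ := HomogeneousLocalization.mk_surjective x
    have hx : (x.num : CoordRing K n) ∈ P := by
      by_contra hx
      refine hrs _ List.mem_cons_self (IsUnit.map _ ?_)
      rw [← HomogeneousLocalization.isUnit_iff_isUnit_val, HomogeneousLocalization.val_mk]
      let y : P.primeCompl := ⟨x.num, hx⟩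
      refine IsUnit.of_mul_eq_one (Localization.mk (x.den : CoordRing K n) y) ?_
      rw [Localization.mk_mul, ← Localization.mk_one, Localization.mk_eq_mk_iff,
        Localization.r_iff_exists]
      exact ⟨1, by simp [y, mul_comm]⟩
    refine hF (hr ?_)
    simp only [smul_eq_mul, mul_zero]
    exact hkill x hx

end Stalks

/-! ### The point X p = 0 of the line; X p is a nonzerodivisor modulo the rope. -/

namespace LineCoords

variable {K : Type*} [Field K] {n : ℕ} {J : Ideal (CoordRing K n)} (c : LineCoords J)

/-- Restriction of forms to the point of the line where `X p = 0`. -/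
def resPt : CoordRing K n →ₐ[K] Polynomial K :=
  aeval fun j => Polynomial.C (c.mu j) * Polynomial.X

theorem sub_aeval_resPt_mem (f : CoordRing K n) :
    f - Polynomial.aeval (X c.q : CoordRing K n) (c.resPt f) ∈ J ⊔ Ideal.span {X c.p} := by
  have : (Ideal.Quotient.mkₐ K (J ⊔ Ideal.span {X c.p})) =
      ((Ideal.Quotient.mkₐ K (J ⊔ Ideal.span {X c.p})).comp
        (Polynomial.aeval (X c.q : CoordRing K n))).comp c.resPt := by
    apply algHom_ext
    intro j
    simp only [AlgHom.comp_apply, Ideal.Quotient.mkₐ_eq_mk]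
    rw [Ideal.Quotient.eq, resPt, aeval_X, map_mul, Polynomial.aeval_C, Polynomial.aeval_X,
      algebraMap_eq]
    have h := Ideal.add_mem (J ⊔ Ideal.span {X c.p})
      (Ideal.mem_sup_left (c.X_sub_mem j))
      (Ideal.mem_sup_right (Ideal.mul_mem_left _ (C (c.lam j)) (Ideal.mem_span_singleton_self _)))
    convert h using 1
    ring
  exact Ideal.Quotient.eq.1 (DFunLike.congr_fun this f)

theorem ker_resPt : RingHom.ker c.resPt = J ⊔ Ideal.span {X c.p} := by
  apply le_antisymm
  · intro f hf
    have := c.sub_aeval_resPt_mem f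
    rwa [RingHom.mem_ker.1 hf, map_zero, sub_zero] at this
  · rw [sup_le_iff, Ideal.span_singleton_le_iff_mem]
    constructor
    · intro f hf
      have h : c.resPt = (aeval ![0, Polynomial.X]).comp c.res := by
        apply algHom_ext
        intro j
        simp [resPt, res]
      rw [RingHom.mem_ker, h, AlgHom.comp_apply, c.res_eq_zero.2 hf, map_zero]
    · simp [RingHom.mem_ker, resPt, c.mu_p]

theorem resPt_X_q : c.resPt (X c.q) = Polynomial.X := by simp [resPt, c.mu_q]

/-- The point of the line where `X p = 0`. -/
def pt : ProjectiveSpectrum (grading K n) where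
  asHomogeneousIdeal := ⟨RingHom.ker c.resPt, by
    rw [ker_resPt]
    refine c.isHomogeneous.sup (Ideal.homogeneous_span _ _ ?_)
    rintro _ rfl
    exact ⟨1, isHomogeneous_X K _⟩⟩
  isPrime := RingHom.ker_isPrime c.resPt
  not_irrelevant_le h := by
    have h1 : (X c.q : CoordRing K n) ∈ RingHom.ker c.resPt :=
      h (HomogeneousIdeal.mem_irrelevant_of_mem _ one_pos (isHomogeneous_X K c.q))
    rw [RingHom.mem_ker, resPt_X_q] at h1
    exact Polynomial.X_ne_zero h1

/-- The generic point of the line. -/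
def genericPt (c : LineCoords J) : ProjectiveSpectrum (grading K n) where
  asHomogeneousIdeal := ⟨J, c.isHomogeneous⟩
  isPrime := c.isPrime
  not_irrelevant_le h := c.X_p_notMem
    (h (HomogeneousIdeal.mem_irrelevant_of_mem _ one_pos (isHomogeneous_X K c.p)))

variable {I : Ideal (CoordRing K n)}

/-- The generic point of the line, whose ideal is `J`, lies in the zero locus of `I`. -/
theorem le_of_zeroLocus_eq (c : LineCoords J)
    (h : ProjectiveSpectrum.zeroLocus (grading K n) (I : Set (CoordRing K n)) =
      ProjectiveSpectrum.zeroLocus (grading K n) (J : Set (CoordRing K n))) : I ≤ J := by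
  have h1 : c.genericPt ∈ ProjectiveSpectrum.zeroLocus (grading K n) (J : Set (CoordRing K n)) :=
    fun f hf => hf
  rw [← h] at h1
  exact h1

/-- If `f ∉ I` is killed modulo `I` by the ideal of the point where `X p = 0`, then `f` has nonzero
germ at that point. -/
theorem mul_notMem_of_notMem (hI : I.IsHomogeneous (grading K n)) (hsat : IsSaturated I)
    {d : ℕ} {f : CoordRing K n} (hf : f.IsHomogeneous d) (hfI : f ∉ I)
    (hP : ∀ u ∈ RingHom.ker c.resPt, u * f ∈ I) {u : CoordRing K n}
    (hu : u ∉ RingHom.ker c.resPt) : u * f ∉ I := by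
  intro huf
  -- Modulo the ideal of the point, `X i ^ m` is a scalar multiple of `X q ^ m`. If `X q ^ m` killed
  -- `f`, so would every `X i ^ m`, and saturation would give `f ∈ I`.
  have ht : ∀ m : ℕ, X c.q ^ m * f ∉ I := by
    intro m hm
    refine hfI (hsat f fun i => ⟨m, ?_⟩)
    have h1 : (X i ^ m - C (c.mu i ^ m) * X c.q ^ m : CoordRing K n) ∈ RingHom.ker c.resPt := by
      rw [RingHom.mem_ker, map_sub, map_mul, map_pow, map_pow (c.resPt) (X c.q), resPt_X_q]
      simp [resPt, mul_pow]
    have h2 := I.add_mem (hP _ h1) (I.mul_mem_left (C (c.mu i ^ m)) hm)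
    convert h2 using 1
    ring
  have hw : Polynomial.aeval (X c.q : CoordRing K n) (c.resPt u) * f ∈ I := by
    have h1 := hP _ (c.ker_resPt ▸ c.sub_aeval_resPt_mem u)
    have h2 := I.sub_mem huf h1
    convert h2 using 1
    ring
  -- Modulo the ideal of the point, `u` is a nonzero polynomial in X q. Homogeneity of `I` isolates
  -- one nonzero term, so a power of X q kills `f`.
  obtain ⟨k, hk⟩ : ∃ k, (c.resPt u).coeff k ≠ 0 := by
    by_contra! h
    exact hu (RingHom.mem_ker.2 (Polynomial.ext (by simpa using h)))
  refine ht k ?_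
  have h1 := homogeneousComponent_mem_of_mem hI hw (k + d)
  rw [Polynomial.aeval_eq_sum_range, Finset.sum_mul, map_sum, Finset.sum_eq_single k] at h1
  · rw [smul_mul_assoc, map_smul, homogeneousComponent_of_mem (n := k + d)
      ((by simpa using ((isHomogeneous_X K c.q).pow k).mul hf :
        (X c.q ^ k * f).IsHomogeneous (k + d))), if_pos rfl, smul_eq_C_mul] at h1
    have h2 := I.mul_mem_left (C ((c.resPt u).coeff k)⁻¹) h1
    rwa [← mul_assoc, ← C_mul, inv_mul_cancel₀ hk, C_1, one_mul] at h2
  · intro b _ hb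
    rw [smul_mul_assoc, map_smul, homogeneousComponent_of_mem (n := b + d)
      ((by simpa using ((isHomogeneous_X K c.q).pow b).mul hf :
        (X c.q ^ b * f).IsHomogeneous (b + d))), if_neg (by omega), smul_zero]
  · intro hk'
    rw [Finset.mem_range, not_lt] at hk'
    exact absurd (Polynomial.coeff_eq_zero_of_natDegree_lt (by omega)) hk

/-- `X p` is a nonzerodivisor on the coordinate ring of a rope. -/
theorem mem_of_X_mul_mem (hI : I.IsHomogeneous (grading K n)) (hsat : IsSaturated I)
    (hCM : IsLocallyCohenMacaulay I) (hIJ : I ≤ J) (hJI : J ^ 2 ≤ I)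
    {f : CoordRing K n} (hf : X c.p * f ∈ I) : f ∈ I := by
  apply mem_ideal_of_comp
  intro d
  set f' := homogeneousComponent d f with hf'
  have hd : f'.IsHomogeneous d := homogeneousComponent_isHomogeneous d f
  have hsf : X c.p * f' ∈ I := by
    have h := comp_mem_ideal hI hf ((1 : ℕ) + (d : ℤ))
    rwa [comp_mul (isHomogeneous_X K c.p) rfl, comp_natCast] at h
  by_contra hfI
  have hfJ : f' ∈ J := (c.isPrime.mem_or_mem (hIJ hsf)).resolve_left c.X_p_notMem
  -- The ideal of the point is J + (X p): `J` kills `f'` since `f' ∈ J` and J² ⊆ I, and X p kills it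
  -- by assumption.
  have hP : ∀ u ∈ RingHom.ker c.resPt, u * f' ∈ I := by
    intro u hu
    rw [c.ker_resPt, Submodule.mem_sup] at hu
    obtain ⟨a, ha, b, hb, rfl⟩ := hu
    obtain ⟨b, rfl⟩ := Ideal.mem_span_singleton'.1 hb
    rw [add_mul]
    refine I.add_mem (hJI ?_) ?_
    · rw [pow_two]
      exact Ideal.mul_mem_mul ha hfJ
    · rw [mul_assoc]
      exact I.mul_mem_left _ hsf
  have hmem : c.pt ∈ ProjectiveSpectrum.zeroLocus (grading K n) (I : Set (CoordRing K n)) := by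
    intro g hg
    change g ∈ RingHom.ker c.resPt
    rw [c.ker_resPt]
    exact Ideal.mem_sup_left (hIJ hg)
  have hsn : ∀ u ∉ RingHom.ker c.resPt, ∀ m : ℕ, u * X c.p ^ m ∉ I := by
    intro u hu m hm
    rcases c.isPrime.mem_or_mem (hIJ hm) with h | h
    · refine hu ?_
      rw [c.ker_resPt]
      exact Ideal.mem_sup_left h
    · exact c.X_p_notMem (c.isPrime.mem_of_pow_mem m h)
  -- Cohen–Macaulayness makes the germ of `f'` at the point zero; saturation makes it nonzero.
  obtain ⟨u, hu, huf⟩ := exists_mul_mem_of_isCohenMacaulayLocalRing (hCM c.pt hmem)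
    (isHomogeneous_X K c.p) (isHomogeneous_X K c.q) (d := d) (f := f') (by rwa [mul_one])
    (show X c.p ∈ RingHom.ker c.resPt by
      rw [c.ker_resPt]
      exact Ideal.mem_sup_right (Ideal.mem_span_singleton_self _))
    (show X c.q ∉ RingHom.ker c.resPt by
      rw [RingHom.mem_ker, resPt_X_q]
      exact Polynomial.X_ne_zero)
    hP hsn
  exact c.mul_notMem_of_notMem hI hsat hd hfI hP hu huf

end LineCoords

/-! ### Dimension counts and divisibility for powers of two variables. -/

section Counting

/-- The dimension of a sum of images under two commuting injections whose intersection is as small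
as possible. -/
theorem finrank_map_sup_map {K E : Type*} [Field K] [AddCommGroup E] [Module K E]
    {σ τ : E →ₗ[K] E} (hσ : Function.Injective σ) (hτ : Function.Injective τ)
    (hστ : ∀ x, σ (τ x) = τ (σ x)) {T₀ T₁ T₂ : Submodule K E}
    [FiniteDimensional K T₁] [FiniteDimensional K T₂]
    (h₁ : ∀ x ∈ T₀, τ x ∈ T₁) (h₂ : ∀ x ∈ T₀, σ x ∈ T₂)
    (h : ∀ x ∈ T₁, ∀ y ∈ T₂, σ x = τ y → ∃ g ∈ T₀, x = τ g) :
    Module.finrank K (T₁.map σ ⊔ T₂.map τ : Submodule K E) + Module.finrank K T₀ =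
      Module.finrank K T₁ + Module.finrank K T₂ := by
  have hinf : T₁.map σ ⊓ T₂.map τ = T₀.map (σ.comp τ) := by
    ext x
    constructor
    · rintro ⟨⟨a, ha, rfl⟩, ⟨b, hb, hab⟩⟩
      obtain ⟨g, hg, rfl⟩ := h a ha b hb hab.symm
      exact ⟨g, hg, rfl⟩
    · rintro ⟨g, hg, rfl⟩
      exact ⟨⟨τ g, h₁ g hg, rfl⟩, ⟨σ g, h₂ g hg, (hστ g).symm⟩⟩
  have e₀ := (Submodule.equivMapOfInjective (σ.comp τ) (hσ.comp hτ) T₀).finrank_eq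
  have e₁ := (Submodule.equivMapOfInjective σ hσ T₁).finrank_eq
  have e₂ := (Submodule.equivMapOfInjective τ hτ T₂).finrank_eq
  have := Submodule.finrank_sup_add_finrank_inf_eq (T₁.map σ) (T₂.map τ)
  rw [hinf] at this
  omega

end Counting

section Regular

variable {K : Type*} [Field K] {n : ℕ}

theorem mem_of_pow_mul_mem {T : Ideal (CoordRing K n)} {s : CoordRing K n}
    (hs : ∀ f, s * f ∈ T → f ∈ T) (m : ℕ) {f : CoordRing K n} (hf : s ^ m * f ∈ T) : f ∈ T := by
  induction m with
  | zero => simpa using hf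
  | succ m ih =>
    rw [pow_succ', mul_assoc] at hf
    exact ih (hs _ hf)

theorem X_pow_dvd_of_mul_eq {i j : Fin (n + 1)} (hij : i ≠ j) {a b : ℕ} {x y : CoordRing K n}
    (h : X i ^ a * x = X j ^ b * y) : X j ^ b ∣ x := by
  have hp : Prime (X j : CoordRing K n) := MvPolynomial.X_prime
  refine hp.pow_dvd_of_dvd_mul_left b (fun hd => hij ?_) ⟨y, h⟩
  exact ((X_dvd_X (R := K)).1 (hp.dvd_of_dvd_pow hd)).symm

/-- A monomial in two variables of degree at least a + b - 1 is divisible by `X 0 ^ a` or `X 1 ^ b`.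
-/
theorem exists_eq_X_pow_add_X_pow {f : CoordRing K 1} {w : ℤ} (hf : f ∈ gradedPiece K 1 w)
    {a b : ℕ} (hw : (a : ℤ) + b - 1 ≤ w) :
    ∃ f₁ ∈ gradedPiece K 1 (w - a), ∃ f₂ ∈ gradedPiece K 1 (w - b),
      f = X 0 ^ a * f₁ + X 1 ^ b * f₂ := by
  have h1 : f ∈ Ideal.span {(X 0 : CoordRing K 1) ^ a, X 1 ^ b} := by
    have hset : ({(X 0 : CoordRing K 1) ^ a, X 1 ^ b} : Set (CoordRing K 1)) =
        (fun d => monomial d (1 : K)) '' {Finsupp.single 0 a, Finsupp.single 1 b} := by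
      rw [Set.image_pair, X_pow_eq_monomial, X_pow_eq_monomial]
    rw [hset, mem_ideal_span_monomial_image]
    intro d hd
    have hdeg : (d 0 + d 1 : ℤ) = w := by
      by_cases h : 0 ≤ w
      · rw [gradedPiece, if_pos h] at hf
        have := IsHomogeneous.degree_eq_sum_deg_support hf hd
        rw [← Finsupp.degree_apply, Finsupp.degree_eq_sum, Fin.sum_univ_two] at this
        omega
      · rw [gradedPiece_of_neg (not_le.1 h), Submodule.mem_bot] at hf
        simp [hf] at hd
    by_cases ha : a ≤ d 0
    · exact ⟨_, Or.inl rfl, Finsupp.single_le_iff.2 ha⟩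
    · exact ⟨_, Or.inr rfl, Finsupp.single_le_iff.2 (by omega)⟩
  obtain ⟨x, y, hxy⟩ := Ideal.mem_span_pair.1 h1
  refine ⟨comp (w - a) x, comp_mem_gradedPiece _ _, comp (w - b) y, comp_mem_gradedPiece _ _, ?_⟩
  rw [← comp_mul (isHomogeneous_X_pow 0 a) (w' := w) (by ring),
    ← comp_mul (isHomogeneous_X_pow 1 b) (w' := w) (by ring), ← map_add]
  conv_lhs => rw [← comp_eq_self hf, ← hxy]
  congr 1
  ring

end Regular

/-! ### Koszul counts for I and J; the conormal module and the kernel N. -/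

namespace LineCoords

variable {K : Type*} [Field K] {n : ℕ} {J : Ideal (CoordRing K n)} (c : LineCoords J)

/-- The subspace `X p ^ a * T_{d+b} + X q ^ b * T_{d+a}` of `T_{d+a+b}`. -/
def span2 (T : Ideal (CoordRing K n)) (a b : ℕ) (d : ℤ) : Submodule K (CoordRing K n) :=
  (piece T (d + b)).map (mulL (X c.p ^ a)) ⊔ (piece T (d + a)).map (mulL (X c.q ^ b))

theorem mem_span2 {T : Ideal (CoordRing K n)} {a b : ℕ} {d : ℤ} {x : CoordRing K n} :
    x ∈ c.span2 T a b d ↔ ∃ u ∈ piece T (d + b), ∃ v ∈ piece T (d + a),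
      X c.p ^ a * u + X c.q ^ b * v = x := by
  simp [span2, Submodule.mem_sup]

theorem span2_le (T : Ideal (CoordRing K n)) (a b : ℕ) (d : ℤ) :
    c.span2 T a b d ≤ piece T (d + a + b) := by
  intro x hx
  obtain ⟨u, hu, v, hv, rfl⟩ := c.mem_span2.1 hx
  exact Submodule.add_mem _ (mul_mem_piece (isHomogeneous_X_pow _ _) hu (by ring))
    (mul_mem_piece (isHomogeneous_X_pow _ _) hv (by ring))

theorem span2_mono {T T' : Ideal (CoordRing K n)} (h : T ≤ T') (a b : ℕ) (d : ℤ) :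
    c.span2 T a b d ≤ c.span2 T' a b d :=
  sup_le_sup (Submodule.map_mono (piece_mono h _)) (Submodule.map_mono (piece_mono h _))

instance finiteDimensional_span2 (T : Ideal (CoordRing K n)) (a b : ℕ) (d : ℤ) :
    FiniteDimensional K (c.span2 T a b d) :=
  Submodule.finiteDimensional_of_le (c.span2_le T a b d)

theorem piece_of_mul {T : Ideal (CoordRing K n)} {i : Fin (n + 1)}
    (hT : ∀ f, X i * f ∈ T → f ∈ T) {b : ℕ} {w w' : ℤ} (hw : w' = b + w) {g : CoordRing K n}
    (hg : X i ^ b * g ∈ piece T w') : g ∈ piece T w :=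
  ⟨mem_gradedPiece_of_mul (isHomogeneous_X_pow i b) (pow_ne_zero _ (X_ne_zero i)) hw hg.1,
    mem_of_pow_mul_mem hT b hg.2⟩

/-- Exactness of the Koszul complex of `X p ^ a`, `X q ^ b` on `T`: a coincidence in the sum is a
common multiple `X p ^ a * X q ^ b * g`, and `g` lies in `T` because X q is a nonzerodivisor modulo
`T`. -/
theorem finrank_span2 {T : Ideal (CoordRing K n)} (hq : ∀ f, X c.q * f ∈ T → f ∈ T)
    (a b : ℕ) (d : ℤ) :
    Module.finrank K (c.span2 T a b d) + Module.finrank K (piece T d) =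
      Module.finrank K (piece T (d + b)) + Module.finrank K (piece T (d + a)) := by
  apply finrank_map_sup_map
  · exact mul_right_injective₀ (pow_ne_zero _ (X_ne_zero _))
  · exact mul_right_injective₀ (pow_ne_zero _ (X_ne_zero _))
  · intro x
    simp only [mulL, LinearMap.mulLeft_apply]
    ring
  · intro x hx
    exact mul_mem_piece (isHomogeneous_X_pow _ _) hx (by ring)
  · intro x hx
    exact mul_mem_piece (isHomogeneous_X_pow _ _) hx (by ring)
  · intro x hx y hy hxy
    simp only [mulL, LinearMap.mulLeft_apply] at hxy
    obtain ⟨g, rfl⟩ := X_pow_dvd_of_mul_eq c.p_ne_q hxy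
    exact ⟨g, piece_of_mul hq (by ring) hx, rfl⟩

/-- The element of `J` with given coordinates in `J / J ^ 2`. -/
def conormal : (Fin (n - 1) → CoordRing K 1) →ₗ[K] CoordRing K n :=
  ∑ i, (LinearMap.mulRight K (c.l i)).comp (c.ext.toLinearMap.comp (LinearMap.proj i))

theorem conormal_apply (x : Fin (n - 1) → CoordRing K 1) :
    c.conormal x = ∑ i, c.ext (x i) * c.l i := by
  simp [conormal]

theorem conormal_mul (f : CoordRing K 1) (x : Fin (n - 1) → CoordRing K 1) :
    c.conormal (fun i => f * x i) = c.ext f * c.conormal x := by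
  simp only [conormal_apply, map_mul, Finset.mul_sum, mul_assoc]

theorem l_mem (i : Fin (n - 1)) : c.l i ∈ J := by
  have h : c.l i ∈ Ideal.span (Set.range c.l) := Ideal.subset_span ⟨i, rfl⟩
  rwa [← c.span_l] at h

/-- Vectors of forms of degree `w - 1`. -/
def coordPiece (K : Type*) [Field K] (n : ℕ) (w : ℤ) : Submodule K (Fin (n - 1) → CoordRing K 1) :=
  Submodule.pi Set.univ fun _ => gradedPiece K 1 (w - 1)

theorem mem_coordPiece {w : ℤ} {x : Fin (n - 1) → CoordRing K 1} :
    x ∈ coordPiece K n w ↔ ∀ i, x i ∈ gradedPiece K 1 (w - 1) := by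
  simp [coordPiece, Submodule.mem_pi]

theorem coordPiece_eq_range (w : ℤ) : coordPiece K n w =
    LinearMap.range ((gradedPiece K 1 (w - 1)).subtype.compLeft (Fin (n - 1))) := by
  ext x
  rw [mem_coordPiece]
  constructor
  · intro h
    exact ⟨fun i => ⟨x i, h i⟩, rfl⟩
  · rintro ⟨y, rfl⟩ i
    exact (y i).2

instance finiteDimensional_coordPiece (w : ℤ) : FiniteDimensional K (coordPiece K n w) := by
  rw [coordPiece_eq_range]
  infer_instance

theorem finrank_coordPiece (hn : 1 ≤ n) (w : ℤ) :
    (Module.finrank K (coordPiece K n w) : ℤ) = ((n : ℤ) - 1) * max w 0 := by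
  rw [coordPiece_eq_range, LinearMap.finrank_range_of_inj, Module.finrank_pi_fintype]
  · rw [Finset.sum_const, Finset.card_univ, Fintype.card_fin, smul_eq_mul, Nat.cast_mul,
      finrank_gradedPiece_one]
    push_cast [hn]
    ring_nf
  · intro x y hxy
    funext i
    exact Subtype.ext (congrFun hxy i)

theorem conormal_mem_piece {w : ℤ} {x : Fin (n - 1) → CoordRing K 1}
    (hx : x ∈ coordPiece K n w) : c.conormal x ∈ piece J w := by
  rw [conormal_apply]
  refine Submodule.sum_mem _ fun i _ => ?_
  rw [mul_comm]
  exact ⟨mul_mem_gradedPiece (c.l_hom i) (c.ext_mem_gradedPiece (mem_coordPiece.1 hx i))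
    (by push_cast; ring), J.mul_mem_right _ (c.l_mem i)⟩

/-- Replacing each coefficient of the generators `l i` by its restriction to the line changes it by
an element of `J`, hence the sum by an element of J². -/
theorem exists_sub_conormal_mem {w : ℤ} {f : CoordRing K n} (hf : f ∈ piece J w) :
    ∃ x ∈ coordPiece K n w, f - c.conormal x ∈ J ^ 2 := by
  obtain ⟨hf1, hf2⟩ := hf
  have h : f ∈ Ideal.span (Set.range c.l) := by
    rw [← c.span_l]
    exact hf2
  obtain ⟨a, rfl⟩ := (Ideal.mem_span_range_iff_exists_fun).1 h
  refine ⟨fun i => c.res (comp (w - 1) (a i)),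
    mem_coordPiece.2 fun i => c.res_mem_gradedPiece (comp_mem_gradedPiece _ _), ?_⟩
  rw [← comp_eq_self hf1, map_sum, conormal_apply, ← Finset.sum_sub_distrib]
  refine Ideal.sum_mem _ fun i _ => ?_
  rw [mul_comm (a i), comp_mul (c.l_hom i) (w := w - 1) (by push_cast; ring), mul_comm, ← sub_mul,
    pow_two]
  exact Ideal.mul_mem_mul (c.sub_ext_res_mem _) (c.l_mem i)

variable {I : Ideal (CoordRing K n)}

/-- Modulo J², the coefficients of `f` are binary forms of degree d + a + b - 1. The hypothesis 0 ≤
d is what allows each to be split along `X 0 ^ a` and `X 1 ^ b`. -/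
theorem exists_sub_mem_span2 (hJI : J ^ 2 ≤ I) {a b : ℕ} {d : ℤ} (hd : 0 ≤ d)
    {f : CoordRing K n} (hf : f ∈ piece J (d + a + b)) :
    ∃ g ∈ c.span2 J a b d, f - g ∈ I := by
  obtain ⟨x, hx, hfx⟩ := c.exists_sub_conormal_mem hf
  choose y hy y' hy' hyy using fun i =>
    exists_eq_X_pow_add_X_pow (mem_coordPiece.1 hx i) (a := a) (b := b) (by omega)
  refine ⟨c.conormal x, c.mem_span2.2 ⟨c.conormal y, c.conormal_mem_piece (mem_coordPiece.2 ?_),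
    c.conormal y', c.conormal_mem_piece (mem_coordPiece.2 ?_), ?_⟩, hJI hfx⟩
  · intro i
    convert hy i using 2
    ring
  · intro i
    convert hy' i using 2
    ring
  · have : x = (fun i => X 0 ^ a * y i) + fun i => X 1 ^ b * y' i := funext hyy
    rw [this, map_add, conormal_mul, conormal_mul, map_pow, map_pow, ext_X_zero, ext_X_one]

theorem sup_span2 (hIJ : I ≤ J) (hJI : J ^ 2 ≤ I) {a b : ℕ} {d : ℤ} (hd : 0 ≤ d) :
    piece I (d + a + b) ⊔ c.span2 J a b d = piece J (d + a + b) := by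
  apply le_antisymm
  · exact sup_le (piece_mono hIJ _) (c.span2_le J a b d)
  · intro f hf
    obtain ⟨g, hg, hfg⟩ := c.exists_sub_mem_span2 hJI hd hf
    rw [← sub_add_cancel f g]
    refine Submodule.add_mem_sup ⟨Submodule.sub_mem _ hf.1 (c.span2_le _ _ _ _ hg).1, hfg⟩ hg

/-- The elements of `coordPiece` mapping to `I`. -/
def relPiece (I : Ideal (CoordRing K n)) (w : ℤ) : Submodule K (Fin (n - 1) → CoordRing K 1) :=
  coordPiece K n w ⊓ (I.restrictScalars K).comap c.conormal

instance finiteDimensional_relPiece (w : ℤ) : FiniteDimensional K (c.relPiece I w) :=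
  Submodule.finiteDimensional_of_le (inf_le_left : c.relPiece I w ≤ coordPiece K n w)

/-- The spaces `piece J w` and `coordPiece K n w` have the same image modulo `I`, namely (J/I)_w;
apply rank–nullity to both. -/
theorem finrank_add_finrank_relPiece (hIJ : I ≤ J) (hJI : J ^ 2 ≤ I) (w : ℤ) :
    Module.finrank K (piece J w) + Module.finrank K (c.relPiece I w) =
      Module.finrank K (piece I w) + Module.finrank K (coordPiece K n w) := by
  let π := (I.restrictScalars K).mkQ
  have h1 := LinearMap.finrank_range_add_finrank_ker (π.domRestrict (piece J w))
  have h2 := LinearMap.finrank_range_add_finrank_ker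
    ((π.comp c.conormal).domRestrict (coordPiece K n w))
  have h3 : LinearMap.range (π.domRestrict (piece J w)) =
      LinearMap.range ((π.comp c.conormal).domRestrict (coordPiece K n w)) := by
    ext y
    constructor
    · rintro ⟨⟨f, hf⟩, rfl⟩
      obtain ⟨x, hx, hfx⟩ := c.exists_sub_conormal_mem hf
      refine ⟨⟨x, hx⟩, ?_⟩
      exact ((Submodule.Quotient.eq _).2 (hJI hfx)).symm
    · rintro ⟨⟨x, hx⟩, rfl⟩
      exact ⟨⟨c.conormal x, c.conormal_mem_piece hx⟩, rfl⟩
  have h4 : Module.finrank K (LinearMap.ker (π.domRestrict (piece J w))) =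
      Module.finrank K (piece I w) := by
    have : piece I w = (LinearMap.ker (π.domRestrict (piece J w))).map (piece J w).subtype := by
      rw [LinearMap.ker_domRestrict, Submodule.map_comap_subtype, Submodule.ker_mkQ]
      ext f
      exact ⟨fun h => ⟨⟨h.1, hIJ h.2⟩, h.2⟩, fun h => ⟨h.1.1, h.2⟩⟩
    rw [this]
    exact (Submodule.equivMapOfInjective _ (Submodule.injective_subtype _) _).finrank_eq
  have h5 : Module.finrank K
      (LinearMap.ker ((π.comp c.conormal).domRestrict (coordPiece K n w))) =
      Module.finrank K (c.relPiece I w) := by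
    have : c.relPiece I w =
        (LinearMap.ker ((π.comp c.conormal).domRestrict (coordPiece K n w))).map
          (coordPiece K n w).subtype := by
      rw [LinearMap.ker_domRestrict, Submodule.map_comap_subtype, LinearMap.ker_comp,
        Submodule.ker_mkQ, relPiece]
    rw [this]
    exact (Submodule.equivMapOfInjective _ (Submodule.injective_subtype _) _).finrank_eq
  rw [h4] at h1
  rw [h5] at h2
  rw [h3] at h1
  omega

/-- Multiplication by a form, on vectors of forms. -/
def mulVec (ι : Type*) (f : CoordRing K 1) : (ι → CoordRing K 1) →ₗ[K] (ι → CoordRing K 1) :=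
  (LinearMap.mulLeft K f).compLeft ι

theorem mulVec_injective (ι : Type*) {f : CoordRing K 1} (hf : f ≠ 0) :
    Function.Injective (mulVec ι f) := by
  intro x y h
  funext i
  have hi : f * x i = f * y i := congrFun h i
  exact mul_left_cancel₀ hf hi

theorem mulVec_mem_relPiece {f : CoordRing K 1} {e : ℕ} (hf : f.IsHomogeneous e) {w w' : ℤ}
    (hw : w' = e + w) {x : Fin (n - 1) → CoordRing K 1} (hx : x ∈ c.relPiece I w) :
    mulVec _ f x ∈ c.relPiece I w' := by
  refine ⟨mem_coordPiece.2 fun i =>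
    mul_mem_gradedPiece hf (mem_coordPiece.1 hx.1 i) (by rw [hw]; ring), ?_⟩
  change c.conormal (fun i => f * x i) ∈ I
  rw [conormal_mul]
  exact I.mul_mem_left _ hx.2

/-- With N the kernel, the Koszul count gives X_0^m N + X_1^m N, taken in degree z + 2m, dimension 2
dim N_{z+m} - dim N_z. The cofactor of a common multiple stays in N because X q is a nonzerodivisor
modulo `I`. -/
theorem finrank_relPiece_convex (hq : ∀ f, X c.q * f ∈ I → f ∈ I) (m : ℕ) (z : ℤ) :
    2 * Module.finrank K (c.relPiece I (z + m)) ≤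
      Module.finrank K (c.relPiece I (z + m + m)) + Module.finrank K (c.relPiece I z) := by
  have h := finrank_map_sup_map (σ := mulVec (Fin (n - 1)) (X 0 ^ m : CoordRing K 1))
    (τ := mulVec (Fin (n - 1)) (X 1 ^ m : CoordRing K 1)) (T₀ := c.relPiece I z)
    (T₁ := c.relPiece I (z + m)) (T₂ := c.relPiece I (z + m))
    (mulVec_injective _ (pow_ne_zero _ (X_ne_zero _)))
    (mulVec_injective _ (pow_ne_zero _ (X_ne_zero _)))
    (fun x => funext fun i => mul_left_comm _ _ _)
    (fun x hx => c.mulVec_mem_relPiece (isHomogeneous_X_pow _ _) (by ring) hx)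
    (fun x hx => c.mulVec_mem_relPiece (isHomogeneous_X_pow _ _) (by ring) hx)
    (by
      intro x hx y hy hxy
      have hdvd : ∀ i, ∃ g, x i = X 1 ^ m * g := fun i =>
        X_pow_dvd_of_mul_eq (n := 1) zero_ne_one (congrFun hxy i)
      choose g hg using hdvd
      refine ⟨g, ⟨mem_coordPiece.2 fun i => ?_, ?_⟩, funext hg⟩
      · have := mem_coordPiece.1 hx.1 i
        rw [hg] at this
        exact mem_gradedPiece_of_mul (isHomogeneous_X_pow 1 m) (pow_ne_zero _ (X_ne_zero _))
          (by ring) this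
      · have : c.conormal x ∈ I := hx.2
        rw [funext hg, conormal_mul, map_pow, ext_X_one] at this
        exact mem_of_pow_mul_mem hq m this)
  have hle : (c.relPiece I (z + m)).map (mulVec _ (X 0 ^ m)) ⊔
      (c.relPiece I (z + m)).map (mulVec _ (X 1 ^ m)) ≤ c.relPiece I (z + m + m) := by
    rw [sup_le_iff]
    constructor <;> rintro _ ⟨x, hx, rfl⟩ <;>
      exact c.mulVec_mem_relPiece (isHomogeneous_X_pow _ _) (by ring) hx
  have := Submodule.finrank_mono hle
  omega

/-- The Hilbert function of `J / I`. -/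
def hdiff (J I : Ideal (CoordRing K n)) (w : ℤ) : ℤ :=
  (Module.finrank K (piece J w) : ℤ) - Module.finrank K (piece I w)

/-- The right-hand side measures compatible pairs of elements of J/I, which are sections of E with
bounded denominators, modulo (J/I)_d. The bound follows from Koszul counts for `I` and `J` and from
`span2 J` lying in the graded piece of `J`. -/
theorem le_finrank_inf_span2 (hIJ : I ≤ J) (hqI : ∀ f, X c.q * f ∈ I → f ∈ I) (a b : ℕ) (d : ℤ) :
    hdiff J I (d + b) + hdiff J I (d + a) - hdiff J I d - hdiff J I (d + a + b) ≤
      (Module.finrank K (piece I (d + a + b) ⊓ c.span2 J a b d : Submodule K _) : ℤ) -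
        Module.finrank K (c.span2 I a b d) := by
  have h1 := c.finrank_span2 hqI a b d
  have h2 := c.finrank_span2 (T := J) (fun f hf =>
    (c.isPrime.mem_or_mem hf).resolve_left c.swap.X_p_notMem) a b d
  have h3 := Submodule.finrank_sup_add_finrank_inf_eq (piece I (d + a + b)) (c.span2 J a b d)
  have h4 := Submodule.finrank_mono (sup_le (piece_mono hIJ _) (c.span2_le J a b d) :
    piece I (d + a + b) ⊔ c.span2 J a b d ≤ _)
  unfold hdiff
  omega

/-- In degrees where h is linear, its mixed second difference vanishes. There `sup_span2` makes the
dimension count an equality, so the two spaces agree. -/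
theorem inf_span2_le (hIJ : I ≤ J) (hJI : J ^ 2 ≤ I) (hqI : ∀ f, X c.q * f ∈ I → f ∈ I)
    {A B w₀ : ℤ} (hw₀ : 0 ≤ w₀) (hh : ∀ w, w₀ ≤ w → hdiff J I w = A * w + B) (a b : ℕ) {d : ℤ}
    (hd : w₀ ≤ d) : piece I (d + a + b) ⊓ c.span2 J a b d ≤ c.span2 I a b d := by
  have h1 := c.finrank_span2 hqI a b d
  have h2 := c.finrank_span2 (T := J) (fun f hf =>
    (c.isPrime.mem_or_mem hf).resolve_left c.swap.X_p_notMem) a b d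
  have h3 := Submodule.finrank_sup_add_finrank_inf_eq (piece I (d + a + b)) (c.span2 J a b d)
  rw [c.sup_span2 hIJ hJI (hw₀.trans hd)] at h3
  have e1 := hh d hd
  have e2 := hh (d + a) (by omega)
  have e3 := hh (d + b) (by omega)
  have e4 := hh (d + a + b) (by omega)
  unfold hdiff at e1 e2 e3 e4
  refine (Submodule.eq_of_le_of_finrank_eq
    (le_inf (c.span2_le I a b d) (c.span2_mono hIJ a b d)) ?_).ge
  rw [mul_add] at e2 e3
  rw [mul_add, mul_add] at e4
  omega

/-- Sections of `J / I` near the point `X q = 0` of the line have bounded denominators. -/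
theorem exists_sub_mul_mem (hIJ : I ≤ J) (hJI : J ^ 2 ≤ I)
    (hqI : ∀ f, X c.q * f ∈ I → f ∈ I)
    {A B w₀ : ℤ} (hw₀ : 0 ≤ w₀) (hh : ∀ w, w₀ ≤ w → hdiff J I w = A * w + B) {z : ℤ} {m₀ a : ℕ}
    (hz : w₀ ≤ z + m₀) {u v : CoordRing K n} (hu : u ∈ piece J (z + m₀ + a))
    (hv : v ∈ piece J (z + m₀ + a))
    (huv : X c.q ^ (m₀ + a) * u + X c.p ^ (m₀ + a) * v ∈ I) :
    ∃ u₀ ∈ piece J (z + m₀), u - X c.p ^ a * u₀ ∈ piece I (z + m₀ + a) := by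
  -- Moving `X p ^ m₀` onto `v` leaves exponents `a` and `m₀ + a` over the base degree `z + m₀`,
  -- which is already in the linear range.
  have hmem : X c.q ^ (m₀ + a) * u + X c.p ^ (m₀ + a) * v ∈ c.span2 J a (m₀ + a) (z + m₀) := by
    refine c.mem_span2.2 ⟨X c.p ^ m₀ * v, mul_mem_piece (isHomogeneous_X_pow _ _) hv
      (by push_cast; ring), u, hu, ?_⟩
    rw [pow_add, pow_add]
    ring
  obtain ⟨i₁, hi₁, i₂, hi₂, h⟩ := c.mem_span2.1
    (c.inf_span2_le hIJ hJI hqI hw₀ hh a (m₀ + a) hz ⟨⟨(c.span2_le _ _ _ _ hmem).1, huv⟩, hmem⟩)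
  have h' : X c.q ^ (m₀ + a) * (u - i₂) = X c.p ^ a * (i₁ - X c.p ^ m₀ * v) := by
    rw [mul_sub, mul_sub, ← mul_assoc (X c.p ^ a), ← pow_add, add_comm a m₀]
    linear_combination -h
  obtain ⟨u₀, hu₀⟩ := X_pow_dvd_of_mul_eq c.p_ne_q.symm h'
  have hmem' : X c.p ^ a * u₀ ∈ piece J (z + m₀ + a) := by
    rw [← hu₀]
    exact Submodule.sub_mem _ hu (piece_mono hIJ _ hi₂)
  refine ⟨u₀, piece_of_mul (fun f hf => (c.isPrime.mem_or_mem hf).resolve_left c.X_p_notMem)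
    (by ring) hmem', ?_⟩
  rw [← hu₀, sub_sub_cancel]
  exact hi₂

end LineCoords

/-! ### Sections over the standard affine opens. -/

section Sections

variable {K : Type*} [Field K] {n : ℕ} {I : Ideal (CoordRing K n)} {z : ℤ}

local notation "ι" => algebraMap (CoordRing K n) (FractionRing (CoordRing K n))

theorem algebraMap_X_ne_zero (i : Fin (n + 1)) : ι (X i) ≠ 0 := fun h =>
  X_ne_zero (R := K) i (IsFractionRing.injective (CoordRing K n) (FractionRing (CoordRing K n))
    (by rw [h, map_zero]))

theorem sections_denominator {s : CoordRing K n} {e : ℕ} {hs : s.IsHomogeneous e}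
    {x : FractionRing (CoordRing K n)} (hx : x ∈ sections I z s e hs) :
    ∃ m₀ : ℕ, ∀ m, m₀ ≤ m → ∃ f ∈ piece I (z + m * e), ι (s ^ m) * x = ι f := by
  obtain ⟨m₀, f, hfI, hf, h⟩ := hx
  refine ⟨m₀, fun m hm => ?_⟩
  obtain ⟨k, rfl⟩ := Nat.exists_eq_add_of_le hm
  refine ⟨s ^ k * f, mul_mem_piece (hs.pow k) ⟨hf, hfI⟩ (by push_cast; ring), ?_⟩
  rw [map_mul, ← h, pow_add, map_mul]
  ring

theorem sectionsOne_denominator {i : Fin (n + 1)} {x : FractionRing (CoordRing K n)}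
    (hx : x ∈ sectionsOne I z i) :
    ∃ m₀ : ℕ, ∀ m, m₀ ≤ m → ∃ f ∈ piece I (z + m), ι (X i) ^ m * x = ι f := by
  obtain ⟨m₀, h⟩ := sections_denominator hx
  refine ⟨m₀, fun m hm => ?_⟩
  obtain ⟨f, hf, hfx⟩ := h m hm
  exact ⟨f, by simpa using hf, by rwa [map_pow] at hfx⟩

theorem sectionsTwo_denominator {i j : Fin (n + 1)} {x : FractionRing (CoordRing K n)}
    (hx : x ∈ sectionsTwo I z i j) :
    ∃ m₀ : ℕ, ∀ m, m₀ ≤ m → ∃ f ∈ piece I (z + m + m),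
      ι (X i) ^ m * ι (X j) ^ m * x = ι f := by
  obtain ⟨m₀, h⟩ := sections_denominator hx
  refine ⟨m₀, fun m hm => ?_⟩
  obtain ⟨f, hf, hfx⟩ := h m hm
  refine ⟨f, ?_, by rwa [map_pow, map_mul, mul_pow] at hfx⟩
  convert hf using 2
  push_cast
  ring

theorem mem_sectionsOne {i : Fin (n + 1)} {x : FractionRing (CoordRing K n)} {m : ℕ}
    {f : CoordRing K n} (hf : f ∈ piece I (z + m)) (h : ι (X i) ^ m * x = ι f) :
    x ∈ sectionsOne I z i :=
  ⟨m, f, hf.2, by simpa using hf.1, by rwa [map_pow]⟩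

theorem mem_sectionsTwo {i j : Fin (n + 1)} {x : FractionRing (CoordRing K n)} {m : ℕ}
    {f : CoordRing K n} (hf : f ∈ piece I (z + m + m))
    (h : ι (X i) ^ m * ι (X j) ^ m * x = ι f) : x ∈ sectionsTwo I z i j :=
  ⟨m, f, hf.2, by convert (mem_piece.1 hf).1 using 2; push_cast; ring, by rwa [map_pow, map_mul, mul_pow]⟩

theorem sectionsOne_le_sectionsTwo (i j : Fin (n + 1)) :
    sectionsOne I z i ≤ sectionsTwo I z i j := by
  intro x hx
  obtain ⟨m, h⟩ := sectionsOne_denominator hx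
  obtain ⟨f, hf, hfx⟩ := h m le_rfl
  refine mem_sectionsTwo (m := m) (f := X j ^ m * f)
    (mul_mem_piece (isHomogeneous_X_pow _ _) hf (by ring)) ?_
  rw [map_mul, ← hfx, map_pow]
  ring

/-- The element `f / s` of the fraction field. -/
def divL (s : CoordRing K n) : CoordRing K n →ₗ[K] FractionRing (CoordRing K n) :=
  (LinearMap.mulLeft K (ι s)⁻¹).comp
    (IsScalarTower.toAlgHom K (CoordRing K n) (FractionRing (CoordRing K n))).toLinearMap

theorem divL_apply (s f : CoordRing K n) : divL s f = (ι s)⁻¹ * ι f := rfl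

theorem mul_mem_of_sq_le {J : Ideal (CoordRing K n)} (hJI : J ^ 2 ≤ I) {f g : CoordRing K n}
    (hf : f ∈ J) (hg : g ∈ J) : f * g ∈ I :=
  hJI (by rw [pow_two]; exact Ideal.mul_mem_mul hf hg)

/-- Sections on `D₊(X_i X_j)` and `D₊(X_k X_j)` that agree glue to a section on `D₊(X_j)`,
when `X_i` is a nonzerodivisor. -/
theorem mem_sectionsOne_of_mem_sectionsTwo {i j k : Fin (n + 1)} (hik : i ≠ k)
    (hi : ∀ f, X i * f ∈ I → f ∈ I) {x : FractionRing (CoordRing K n)}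
    (h₁ : x ∈ sectionsTwo I z i j) (h₂ : x ∈ sectionsTwo I z k j) : x ∈ sectionsOne I z j := by
  obtain ⟨m₁, h₁⟩ := sectionsTwo_denominator h₁
  obtain ⟨m₂, h₂⟩ := sectionsTwo_denominator h₂
  obtain ⟨f, hf, hfx⟩ := h₁ (max m₁ m₂) (le_max_left _ _)
  obtain ⟨g, hg, hgx⟩ := h₂ (max m₁ m₂) (le_max_right _ _)
  set m := max m₁ m₂
  have h : X k ^ m * f = X i ^ m * g := by
    apply IsFractionRing.injective (CoordRing K n) (FractionRing (CoordRing K n))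
    simp only [map_mul, map_pow, ← hfx, ← hgx]
    ring
  obtain ⟨f₀, rfl⟩ := X_pow_dvd_of_mul_eq hik.symm h
  refine mem_sectionsOne (m := m) (LineCoords.piece_of_mul hi (b := m) (by ring) hf) ?_
  rw [map_mul, map_pow, mul_assoc] at hfx
  exact mul_left_cancel₀ (pow_ne_zero _ (algebraMap_X_ne_zero i)) hfx

theorem mem_X_pow_of_X_pow_mul_mem {i j k : Fin (n + 1)} (hik : k ≠ i) (hjk : k ≠ j) {m : ℕ}
    {f : CoordRing K n} (h : X k ^ m * f ∈ Ideal.span {(X i : CoordRing K n) ^ m, X j ^ m}) :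
    f ∈ Ideal.span {(X i : CoordRing K n) ^ m, X j ^ m} := by
  have hset : ({(X i : CoordRing K n) ^ m, X j ^ m} : Set (CoordRing K n)) =
      (fun d => monomial d (1 : K)) '' {Finsupp.single i m, Finsupp.single j m} := by
    rw [Set.image_pair, X_pow_eq_monomial, X_pow_eq_monomial]
  rw [hset, mem_ideal_span_monomial_image] at h ⊢
  intro d hd
  obtain ⟨e, he, hle⟩ := h (Finsupp.single k m + d) (by
    rw [mem_support_iff] at hd ⊢
    rwa [X_pow_eq_monomial, coeff_monomial_mul, one_mul])
  refine ⟨e, he, ?_⟩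
  rcases he with rfl | rfl
  · rw [Finsupp.single_le_iff] at hle ⊢
    simpa [hik] using hle
  · rw [Finsupp.single_le_iff] at hle ⊢
    simpa [hjk] using hle

end Sections

/-! ### The Rao function from the two opens D₊(X p), D₊(X q). -/

namespace LineCoords

variable {K : Type*} [Field K] {n : ℕ} {I J : Ideal (CoordRing K n)} (c : LineCoords J) {z : ℤ}

local notation "ι" => algebraMap (CoordRing K n) (FractionRing (CoordRing K n))

/-- Sums of sections of the ideal sheaf on the two open sets `D₊(X p)`, `D₊(X q)`. -/
def sumSections (T : Ideal (CoordRing K n)) (z : ℤ) : Submodule K (FractionRing (CoordRing K n)) :=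
  sectionsOne T z c.p ⊔ sectionsOne T z c.q

/-- Sections of the ideal sheaf of the rope on `D₊(X p X q)` whose class in the first cohomology
of the ideal sheaf of the line vanishes. -/
def liftableSections (I : Ideal (CoordRing K n)) (z : ℤ) :
    Submodule K (FractionRing (CoordRing K n)) :=
  sectionsTwo I z c.p c.q ⊓ c.sumSections J z

/-- The first cohomology of the twisted ideal sheaf of a line vanishes. -/
theorem cocycle_mem_sumSections (hn : 2 ≤ n) (hIJ : I ≤ J)
    {x : Fin (n + 1) → Fin (n + 1) → FractionRing (CoordRing K n)}
    (hx : x ∈ cechCocycles I z) : x c.p c.q ∈ c.sumSections J z := by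
  obtain ⟨hx, hcoc⟩ := hx
  obtain ⟨w, hw⟩ : ∃ w, w ∉ ({c.p, c.q} : Finset (Fin (n + 1))) := by
    by_contra! h
    have h1 := Finset.card_le_card (fun w _ => h w : Finset.univ ⊆ _)
    have h2 := Finset.card_le_two (a := c.p) (b := c.q)
    rw [Finset.card_univ, Fintype.card_fin] at h1
    omega
  have hwp : w ≠ c.p := fun h => hw (by simp [h])
  have hwq : w ≠ c.q := fun h => hw (by simp [h])
  obtain ⟨m₁, h₁⟩ := sectionsTwo_denominator (hx c.p c.q)
  obtain ⟨m₂, h₂⟩ := sectionsTwo_denominator (hx c.p w)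
  obtain ⟨m₃, h₃⟩ := sectionsTwo_denominator (hx c.q w)
  set m := m₁ + m₂ + m₃
  obtain ⟨f₁, hf₁, hfx₁⟩ := h₁ m (by omega)
  obtain ⟨f₂, hf₂, hfx₂⟩ := h₂ m (by omega)
  obtain ⟨f₃, hf₃, hfx₃⟩ := h₃ m (by omega)
  -- Clearing denominators in the cocycle relation for `p`, `q` and a third index `w` puts `X w ^ m
  -- * f₁` in (X p ^ m, X q ^ m); the factor `X w ^ m` can then be cancelled.
  have h : X w ^ m * f₁ = (-f₃) * X c.p ^ m + f₂ * X c.q ^ m := by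
    apply IsFractionRing.injective (CoordRing K n) (FractionRing (CoordRing K n))
    simp only [map_mul, map_add, map_neg, map_pow, ← hfx₁, ← hfx₂, ← hfx₃, ← hcoc c.p c.q w]
    ring
  obtain ⟨α, β, hαβ⟩ := Ideal.mem_span_pair.1
    (mem_X_pow_of_X_pow_mul_mem hwp hwq (Ideal.mem_span_pair.2 ⟨_, _, h.symm⟩))
  have hres : X 0 ^ m * c.res α = X 1 ^ m * (-c.res β) := by
    have h1 := c.res_eq_zero.2 (hIJ hf₁.2)
    rw [← hαβ, map_add, map_mul, map_mul, map_pow, map_pow, res_X_p, res_X_q] at h1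
    linear_combination h1
  obtain ⟨η, hη⟩ := X_pow_dvd_of_mul_eq (zero_ne_one) hres
  have hη' : c.res β = - (X 0 ^ m * η) := by
    have h1 : (X 1 : CoordRing K 1) ^ m * (c.res β + X 0 ^ m * η) = 0 := by
      rw [hη] at hres
      linear_combination hres
    rcases mul_eq_zero.1 h1 with h2 | h2
    · exact absurd h2 (pow_ne_zero _ (X_ne_zero _))
    · linear_combination h2
  -- On the line, the relation between `α` and `β` is a multiple `η` of the Koszul syzygy.
  -- Subtracting it puts both cofactors in `J`, and `comp` restores homogeneity.
  have hα : comp (z + m) (α - X c.q ^ m * c.ext η) ∈ piece J (z + m) := by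
    refine ⟨comp_mem_gradedPiece _ _, comp_mem_ideal c.isHomogeneous (c.res_eq_zero.1 ?_) _⟩
    rw [map_sub, map_mul, map_pow, res_ext, res_X_q, hη, sub_self]
  have hβ : comp (z + m) (β + X c.p ^ m * c.ext η) ∈ piece J (z + m) := by
    refine ⟨comp_mem_gradedPiece _ _, comp_mem_ideal c.isHomogeneous (c.res_eq_zero.1 ?_) _⟩
    rw [map_add, map_mul, map_pow, res_ext, res_X_p, hη', neg_add_cancel]
  set α' := comp (z + m) (α - X c.q ^ m * c.ext η)
  set β' := comp (z + m) (β + X c.p ^ m * c.ext η)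
  have hf₁' : f₁ = X c.p ^ m * α' + X c.q ^ m * β' := by
    rw [← comp_mul (isHomogeneous_X_pow c.p m) (w' := z + m + m) (by ring),
      ← comp_mul (isHomogeneous_X_pow c.q m) (w' := z + m + m) (by ring), ← map_add]
    conv_lhs => rw [← comp_eq_self hf₁.1, ← hαβ]
    congr 1
    ring
  have hp := algebraMap_X_ne_zero (K := K) c.p
  have hq := algebraMap_X_ne_zero (K := K) c.q
  have hsum : x c.p c.q = (ι (X c.p) ^ m)⁻¹ * ι β' + (ι (X c.q) ^ m)⁻¹ * ι α' := by
    rw [hf₁', map_add, map_mul, map_mul, map_pow, map_pow] at hfx₁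
    field_simp
    linear_combination hfx₁
  rw [hsum]
  refine Submodule.add_mem_sup (mem_sectionsOne hβ ?_) (mem_sectionsOne hα ?_)
  · rw [mul_inv_cancel_left₀ (pow_ne_zero _ hp)]
  · rw [mul_inv_cancel_left₀ (pow_ne_zero _ hq)]

theorem cocycle_mem_liftableSections (hn : 2 ≤ n) (hIJ : I ≤ J)
    {x : Fin (n + 1) → Fin (n + 1) → FractionRing (CoordRing K n)}
    (hx : x ∈ cechCocycles I z) : x c.p c.q ∈ c.liftableSections I z :=
  ⟨hx.1 _ _, c.cocycle_mem_sumSections hn hIJ hx⟩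

/-- If `x p q = a + b`, then `x p j - a = x q j + b` is a section on both D₊(X p X j) and D₊(X q X
j), so it extends to D₊(X j). These sections bound the cocycle. -/
theorem cocycle_mem_coboundaries_iff (hp : ∀ f, X c.p * f ∈ I → f ∈ I)
    {x : Fin (n + 1) → Fin (n + 1) → FractionRing (CoordRing K n)}
    (hx : x ∈ cechCocycles I z) :
    x c.p c.q ∈ c.sumSections I z ↔ x ∈ cechCoboundaries I z := by
  constructor
  · intro h
    obtain ⟨hx, hcoc⟩ := hx
    obtain ⟨a, ha, b, hb, hab⟩ := Submodule.mem_sup.1 h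
    refine ⟨fun j => x c.p j - a, fun j => ?_, fun i j => ?_⟩
    · apply mem_sectionsOne_of_mem_sectionsTwo c.p_ne_q hp
      · exact Submodule.sub_mem _ (hx _ _) (sectionsOne_le_sectionsTwo _ _ ha)
      · have : x c.p j - a = x c.q j + b := by
          rw [← hcoc c.p c.q j, ← hab]
          ring
        change x c.p j - a ∈ _
        rw [this]
        exact Submodule.add_mem _ (hx _ _) (sectionsOne_le_sectionsTwo _ _ hb)
    · change x i j = x c.p j - a - (x c.p i - a)
      rw [← hcoc c.p i j]
      ring
  · rintro ⟨b, hb, hxb⟩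
    rw [hxb, sub_eq_neg_add]
    exact Submodule.add_mem_sup (Submodule.neg_mem _ (hb _)) (hb _)

/-- A liftable section is `u / X p ^ m + v / X q ^ m` with `u`, `v` compatible modulo `I`. -/
theorem exists_numerators (hp : ∀ f, X c.p * f ∈ I → f ∈ I) (hq : ∀ f, X c.q * f ∈ I → f ∈ I)
    {y : FractionRing (CoordRing K n)} (hy : y ∈ c.liftableSections I z) :
    ∃ m₁ : ℕ, ∀ m, m₁ ≤ m → ∃ u ∈ piece J (z + m), ∃ v ∈ piece J (z + m),
      X c.q ^ m * u + X c.p ^ m * v ∈ I ∧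
      y = (ι (X c.p) ^ m)⁻¹ * ι u + (ι (X c.q) ^ m)⁻¹ * ι v := by
  obtain ⟨hy, hy'⟩ := hy
  obtain ⟨a, ha, b, hb, rfl⟩ := Submodule.mem_sup.1 hy'
  obtain ⟨m₁, h₁⟩ := sectionsOne_denominator ha
  obtain ⟨m₂, h₂⟩ := sectionsOne_denominator hb
  obtain ⟨N, h₃⟩ := sectionsTwo_denominator hy
  obtain ⟨f, hf, hfy⟩ := h₃ N le_rfl
  refine ⟨m₁ + m₂, fun m hm => ?_⟩
  obtain ⟨u, hu, hua⟩ := h₁ m (by omega)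
  obtain ⟨v, hv, hvb⟩ := h₂ m (by omega)
  refine ⟨u, hu, v, hv, ?_, ?_⟩
  -- That `y` is a section of the ideal of the rope gives membership in `I` only after
  -- multiplication by powers of X p and X q, which are nonzerodivisors modulo `I`.
  · apply mem_of_pow_mul_mem hp N
    apply mem_of_pow_mul_mem hq N
    have : X c.q ^ N * (X c.p ^ N * (X c.q ^ m * u + X c.p ^ m * v)) =
        X c.p ^ m * X c.q ^ m * f := by
      apply IsFractionRing.injective (CoordRing K n) (FractionRing (CoordRing K n))
      simp only [map_mul, map_add, map_pow, ← hfy, ← hua, ← hvb]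
      ring
    rw [this]
    exact I.mul_mem_left _ hf.2
  · rw [← hua, ← hvb, inv_mul_cancel_left₀ (pow_ne_zero _ (algebraMap_X_ne_zero _)),
      inv_mul_cancel_left₀ (pow_ne_zero _ (algebraMap_X_ne_zero _))]

/-- Every liftable section comes from a Čech cocycle. -/
theorem exists_cocycle (hJI : J ^ 2 ≤ I)
    (hp : ∀ f, X c.p * f ∈ I → f ∈ I) (hq : ∀ f, X c.q * f ∈ I → f ∈ I)
    {y : FractionRing (CoordRing K n)} (hy : y ∈ c.liftableSections I z) :
    ∃ x ∈ cechCocycles I z, x c.p c.q - y ∈ c.sumSections I z := by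
  obtain ⟨m, h⟩ := c.exists_numerators hp hq hy
  obtain ⟨u, hu, v, hv, huv, rfl⟩ := h m le_rfl
  have hAB : ∀ j, ∃ A ∈ gradedPiece K n (m : ℤ), ∃ B ∈ gradedPiece K n (m : ℤ),
      X j ^ (m + m) - (X c.p ^ m * A + X c.q ^ m * B) ∈ J := by
    intro j
    have h1 : (X j ^ (m + m) : CoordRing K n) ∈ gradedPiece K n ((m + m : ℕ) : ℤ) :=
      mem_gradedPiece_natCast.2 (isHomogeneous_X_pow _ _)
    obtain ⟨A, hA, B, hB, hAB⟩ := exists_eq_X_pow_add_X_pow (c.res_mem_gradedPiece h1)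
      (a := m) (b := m) (by push_cast; omega)
    have hm : ((m + m : ℕ) : ℤ) - m = m := by push_cast; ring
    rw [hm] at hA hB
    refine ⟨c.ext A, c.ext_mem_gradedPiece hA, c.ext B, c.ext_mem_gradedPiece hB, ?_⟩
    have h2 := c.sub_ext_res_mem (X j ^ (m + m))
    rwa [hAB, map_add, map_mul, map_mul, map_pow, map_pow, ext_X_zero, ext_X_one] at h2
  choose A hA B hB hAB using hAB
  -- Modulo `I`, v / X q ^ m = -u / X p ^ m is a section of E. Since `X j ^ (m + m)` is X p ^ m A_j
  -- + X q ^ m B_j modulo `J`, the fraction `N j / X j ^ (m + m)` lifts it to 𝓘_L over D₊(X j).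
  -- Differences of these lifts form the cocycle, as in the connecting homomorphism.
  let N : Fin (n + 1) → CoordRing K n := fun j => B j * v - A j * u
  have hN : ∀ j, N j ∈ piece J (z + m + m) := fun j => Submodule.sub_mem _
    (mul_mem_piece (mem_gradedPiece_natCast.1 (hB j)) hv (by ring))
    (mul_mem_piece (mem_gradedPiece_natCast.1 (hA j)) hu (by ring))
  let x : Fin (n + 1) → FractionRing (CoordRing K n) :=
    fun j => (ι (X j) ^ (m + m))⁻¹ * ι (N j)
  have hx : ∀ j, ι (X j) ^ (m + m) * x j = ι (N j) := fun j =>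
    mul_inv_cancel_left₀ (pow_ne_zero _ (algebraMap_X_ne_zero j)) _
  refine ⟨fun i j => x j - x i, ⟨fun i j => ?_, fun i j l => by ring⟩, ?_⟩
  · refine mem_sectionsTwo (m := m + m)
      (f := X i ^ (m + m) * N j - X j ^ (m + m) * N i) ⟨?_, ?_⟩ ?_
    · exact Submodule.sub_mem _
        (mul_mem_gradedPiece (isHomogeneous_X_pow _ _) (hN j).1 (by push_cast; ring))
        (mul_mem_gradedPiece (isHomogeneous_X_pow _ _) (hN i).1 (by push_cast; ring))
    · change _ ∈ I
      have h1 := I.sub_mem (I.add_mem (mul_mem_of_sq_le hJI (hAB i) (hN j).2)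
        (I.mul_mem_left (A i * B j - A j * B i) huv))
        (mul_mem_of_sq_le hJI (hAB j) (hN i).2)
      convert h1 using 1
      simp only [N]
      ring
    · rw [map_sub, map_mul, map_mul, map_pow, map_pow, ← hx i, ← hx j]
      ring
  · have e : x c.q - x c.p - ((ι (X c.p) ^ m)⁻¹ * ι u + (ι (X c.q) ^ m)⁻¹ * ι v) =
        -(x c.p + (ι (X c.p) ^ m)⁻¹ * ι u) + (x c.q - (ι (X c.q) ^ m)⁻¹ * ι v) := by ring
    have hu' : ι (X c.p) ^ m * ((ι (X c.p) ^ m)⁻¹ * ι u) = ι u :=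
      mul_inv_cancel_left₀ (pow_ne_zero _ (algebraMap_X_ne_zero _)) _
    have hv' : ι (X c.q) ^ m * ((ι (X c.q) ^ m)⁻¹ * ι v) = ι v :=
      mul_inv_cancel_left₀ (pow_ne_zero _ (algebraMap_X_ne_zero _)) _
    change x c.q - x c.p - _ ∈ _
    rw [e]
    refine Submodule.add_mem_sup (Submodule.neg_mem _ ?_) ?_
    · refine mem_sectionsOne (m := m + m) (f := N c.p + X c.p ^ m * u) ⟨?_, ?_⟩ ?_
      · rw [Nat.cast_add, ← add_assoc]
        exact Submodule.add_mem _ (hN _).1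
          (mul_mem_gradedPiece (isHomogeneous_X_pow _ _) hu.1 (by ring))
      · apply mem_of_pow_mul_mem hp m
        have h1 := I.add_mem (mul_mem_of_sq_le hJI (hAB c.p) hu.2)
          (I.mul_mem_left (B c.p) huv)
        convert h1 using 1
        simp only [N]
        ring
      · rw [mul_add, hx, map_add, map_mul, map_pow, pow_add, mul_assoc (_ ^ m), hu']
    · refine mem_sectionsOne (m := m + m) (f := N c.q - X c.q ^ m * v) ⟨?_, ?_⟩ ?_
      · rw [Nat.cast_add, ← add_assoc]
        exact Submodule.sub_mem _ (hN _).1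
          (mul_mem_gradedPiece (isHomogeneous_X_pow _ _) hv.1 (by ring))
      · apply mem_of_pow_mul_mem hq m
        have h1 := I.add_mem (mul_mem_of_sq_le hJI (hAB c.q) hv.2)
          (I.mul_mem_left (A c.q) huv)
        have h2 := I.neg_mem h1
        convert h2 using 1
        simp only [N]
        ring
      · rw [mul_sub, hx, map_sub ι (N c.q), map_mul ι (X c.q ^ m), map_pow, pow_add, mul_assoc (_ ^ m), hv']

/-- The first cohomology is computed by the two open sets `D₊(X p)` and `D₊(X q)`. -/
theorem raoFunction_eq (hn : 2 ≤ n) (hJI : J ^ 2 ≤ I) (hIJ : I ≤ J)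
    (hp : ∀ f, X c.p * f ∈ I → f ∈ I) (hq : ∀ f, X c.q * f ∈ I → f ∈ I) :
    raoFunction I z =
      Module.finrank K ((c.liftableSections I z).map (c.sumSections I z).mkQ) := by
  let ev : cechCocycles I z →ₗ[K] FractionRing (CoordRing K n) ⧸ c.sumSections I z :=
    (c.sumSections I z).mkQ.comp
      ((LinearMap.proj c.q).comp ((LinearMap.proj c.p).comp (cechCocycles I z).subtype))
  have hker : LinearMap.ker ev = (cechCoboundaries I z).submoduleOf (cechCocycles I z) := by
    ext x
    rw [LinearMap.mem_ker]
    change (c.sumSections I z).mkQ (x.1 c.p c.q) = 0 ↔ x.1 ∈ cechCoboundaries I z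
    rw [← c.cocycle_mem_coboundaries_iff hp x.2, Submodule.mkQ_apply,
      Submodule.Quotient.mk_eq_zero]
  have hrange : LinearMap.range ev =
      (c.liftableSections I z).map (c.sumSections I z).mkQ := by
    ext y
    constructor
    · rintro ⟨x, rfl⟩
      exact ⟨x.1 c.p c.q, c.cocycle_mem_liftableSections hn hIJ x.2, rfl⟩
    · rintro ⟨y, hy, rfl⟩
      obtain ⟨x, hx, hxy⟩ := c.exists_cocycle hJI hp hq hy
      exact ⟨⟨x, hx⟩, (Submodule.Quotient.eq _).2 hxy⟩
  unfold raoFunction H1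
  rw [← hrange, ← ev.quotKerEquivRange.finrank_eq]
  exact (Submodule.quotEquivOfEq _ _ hker.symm).finrank_eq

/-- Needed because `finrank` is 0 on an infinite-dimensional space, which would void the lower
bound. Modulo `sumSections I`, denominators can be reduced to the fixed exponent `m₀`, by
`exists_sub_mul_mem` at each of the two points of the line. -/
theorem finiteDimensional_liftable (hIJ : I ≤ J) (hJI : J ^ 2 ≤ I)
    (hp : ∀ f, X c.p * f ∈ I → f ∈ I) (hq : ∀ f, X c.q * f ∈ I → f ∈ I)
    {A B w₀ : ℤ} (hw₀ : 0 ≤ w₀) (hh : ∀ w, w₀ ≤ w → hdiff J I w = A * w + B) :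
    FiniteDimensional K ((c.liftableSections I z).map (c.sumSections I z).mkQ) := by
  obtain ⟨m₀, hm₀⟩ : ∃ m₀ : ℕ, w₀ ≤ z + m₀ := ⟨(w₀ - z).toNat, by omega⟩
  let C₀ : Submodule K (FractionRing (CoordRing K n)) :=
    (piece J (z + m₀)).map (divL (X c.p ^ m₀)) ⊔ (piece J (z + m₀)).map (divL (X c.q ^ m₀))
  suffices h : c.liftableSections I z ≤ c.sumSections I z ⊔ C₀ by
    have h1 := Submodule.map_mono (f := (c.sumSections I z).mkQ) h
    rw [Submodule.map_sup, Submodule.mkQ_map_self, bot_sup_eq] at h1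
    exact Submodule.finiteDimensional_of_le h1
  intro y hy
  obtain ⟨m₁, h⟩ := c.exists_numerators hp hq hy
  obtain ⟨u, hu, v, hv, huv, rfl⟩ := h (m₀ + m₁) (by omega)
  rw [Nat.cast_add, ← add_assoc] at hu hv
  obtain ⟨u₀, hu₀, hu₁⟩ := c.exists_sub_mul_mem hIJ hJI hq hw₀ hh hm₀ hu hv huv
  have huv' : X c.p ^ (m₀ + m₁) * v + X c.q ^ (m₀ + m₁) * u ∈ I := by
    convert huv using 1
    ring
  obtain ⟨v₀, hv₀, hv₁⟩ := c.swap.exists_sub_mul_mem hIJ hJI hp hw₀ hh hm₀ hv hu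
    huv'
  change v - X c.q ^ m₁ * v₀ ∈ _ at hv₁
  have hp0 := algebraMap_X_ne_zero (K := K) c.p
  have hq0 := algebraMap_X_ne_zero (K := K) c.q
  have e : (ι (X c.p) ^ (m₀ + m₁))⁻¹ * ι u + (ι (X c.q) ^ (m₀ + m₁))⁻¹ * ι v =
      ((ι (X c.p) ^ (m₀ + m₁))⁻¹ * ι (u - X c.p ^ m₁ * u₀) +
        (ι (X c.q) ^ (m₀ + m₁))⁻¹ * ι (v - X c.q ^ m₁ * v₀)) +
      (divL (X c.p ^ m₀) u₀ + divL (X c.q ^ m₀) v₀) := by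
    simp only [divL_apply, map_sub, map_mul, map_pow]
    field_simp
    ring
  rw [e]
  refine Submodule.add_mem_sup (Submodule.add_mem_sup ?_ ?_)
    (Submodule.add_mem_sup ⟨u₀, hu₀, rfl⟩ ⟨v₀, hv₀, rfl⟩)
  · refine mem_sectionsOne (m := m₀ + m₁) (by rwa [Nat.cast_add, ← add_assoc])
      (mul_inv_cancel_left₀ (pow_ne_zero _ hp0) _)
  · refine mem_sectionsOne (m := m₀ + m₁) (by rwa [Nat.cast_add, ← add_assoc])
      (mul_inv_cancel_left₀ (pow_ne_zero _ hq0) _)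

/-- An element of `span2 J` representing a coboundary lies in `span2 I`. -/
theorem mem_span2_of_divL_mem (hp : ∀ f, X c.p * f ∈ I → f ∈ I)
    (hq : ∀ f, X c.q * f ∈ I → f ∈ I) {m : ℕ} {x : CoordRing K n} (hx : x ∈ c.span2 J m m z)
    (h : divL (X c.p ^ m * X c.q ^ m) x ∈ c.sumSections I z) : x ∈ c.span2 I m m z := by
  obtain ⟨u, hu, v, hv, rfl⟩ := c.mem_span2.1 hx
  obtain ⟨a, ha, b, hb, hab⟩ := Submodule.mem_sup.1 h
  obtain ⟨m₁, h₁⟩ := sectionsOne_denominator ha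
  obtain ⟨m₂, h₂⟩ := sectionsOne_denominator hb
  obtain ⟨f, hf, hfa⟩ := h₁ (m + (m₁ + m₂)) (by omega)
  obtain ⟨g, hg, hgb⟩ := h₂ (m + (m₁ + m₂)) (by omega)
  set k := m₁ + m₂
  have hp0 := algebraMap_X_ne_zero (K := K) c.p
  have hq0 := algebraMap_X_ne_zero (K := K) c.q
  -- Separating the X p and X q denominators in u / X q ^ m + v / X p ^ m = a + b shows that both
  -- sides equal (X p X q) ^ (m + k) times a polynomial `w`. This `w` corrects (u, v) by a Koszul
  -- syzygy into `I`.
  have key : X c.p ^ (m + k) * (X c.q ^ k * u - g) = X c.q ^ (m + k) * (f - X c.p ^ k * v) := by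
    apply IsFractionRing.injective (CoordRing K n) (FractionRing (CoordRing K n))
    rw [divL_apply, eq_inv_mul_iff_mul_eq₀] at hab
    · simp only [map_mul, map_add, map_sub, map_pow, ← hfa, ← hgb] at hab ⊢
      rw [pow_add, pow_add]
      linear_combination (-(ι (X c.p) ^ k * ι (X c.q) ^ k)) * hab
    · rw [map_mul, map_pow, map_pow]
      exact mul_ne_zero (pow_ne_zero _ hp0) (pow_ne_zero _ hq0)
  obtain ⟨w, hw⟩ := X_pow_dvd_of_mul_eq c.p_ne_q key
  have hw' : f - X c.p ^ k * v = X c.p ^ (m + k) * w := by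
    rw [hw] at key
    refine mul_left_cancel₀ (pow_ne_zero (m + k) (X_ne_zero (R := K) c.q)) ?_
    rw [← key]
    ring
  have hu' : u - X c.q ^ m * w ∈ piece I (z + m) := by
    refine piece_of_mul hq (b := k) (w' := z + (m + k : ℕ)) (by push_cast; ring) ?_
    have : X c.q ^ k * (u - X c.q ^ m * w) = g := by
      rw [pow_add] at hw
      linear_combination hw
    rwa [this]
  have hv' : v + X c.p ^ m * w ∈ piece I (z + m) := by
    refine piece_of_mul hp (b := k) (w' := z + (m + k : ℕ)) (by push_cast; ring) ?_
    have : X c.p ^ k * (v + X c.p ^ m * w) = f := by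
      rw [pow_add] at hw'
      linear_combination -hw'
    rwa [this]
  exact c.mem_span2.2 ⟨_, hu', _, hv', by ring⟩

theorem divL_mem_liftableSections {m : ℕ} {x : CoordRing K n} (hxI : x ∈ piece I (z + m + m))
    (hx : x ∈ c.span2 J m m z) :
    divL (X c.p ^ m * X c.q ^ m) x ∈ c.liftableSections I z := by
  have hp0 := algebraMap_X_ne_zero (K := K) c.p
  have hq0 := algebraMap_X_ne_zero (K := K) c.q
  constructor
  · refine mem_sectionsTwo hxI ?_
    rw [divL_apply, map_mul, map_pow, map_pow, mul_inv_cancel_left₀]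
    exact mul_ne_zero (pow_ne_zero _ hp0) (pow_ne_zero _ hq0)
  · obtain ⟨u, hu, v, hv, rfl⟩ := c.mem_span2.1 hx
    have : divL (X c.p ^ m * X c.q ^ m) (X c.p ^ m * u + X c.q ^ m * v) =
        (ι (X c.p) ^ m)⁻¹ * ι v + (ι (X c.q) ^ m)⁻¹ * ι u := by
      simp only [divL_apply, map_add, map_mul, map_pow]
      field_simp
      ring
    rw [this]
    exact Submodule.add_mem_sup
      (mem_sectionsOne hv (mul_inv_cancel_left₀ (pow_ne_zero _ hp0) _))
      (mem_sectionsOne hu (mul_inv_cancel_left₀ (pow_ne_zero _ hq0) _))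

/-- Rank–nullity for x ↦ x / (X p X q) ^ m, which takes values in liftable sections and whose
kernel, modulo `sumSections I`, lies in `span2 I`. -/
theorem finrank_inf_span2_le (hp : ∀ f, X c.p * f ∈ I → f ∈ I)
    (hq : ∀ f, X c.q * f ∈ I → f ∈ I) (m : ℕ)
    [FiniteDimensional K ((c.liftableSections I z).map (c.sumSections I z).mkQ)] :
    Module.finrank K (piece I (z + m + m) ⊓ c.span2 J m m z : Submodule K _) ≤
      Module.finrank K ((c.liftableSections I z).map (c.sumSections I z).mkQ) +
        Module.finrank K (c.span2 I m m z) := by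
  let θ := ((c.sumSections I z).mkQ.comp (divL (X c.p ^ m * X c.q ^ m))).domRestrict
    (piece I (z + m + m) ⊓ c.span2 J m m z)
  have h1 := θ.finrank_range_add_finrank_ker
  have h2 : LinearMap.range θ ≤ (c.liftableSections I z).map (c.sumSections I z).mkQ := by
    rintro _ ⟨x, rfl⟩
    exact ⟨_, c.divL_mem_liftableSections x.2.1 x.2.2, rfl⟩
  have h3 : (LinearMap.ker θ).map (Submodule.subtype _) ≤ c.span2 I m m z := by
    rintro _ ⟨x, hx, rfl⟩
    refine c.mem_span2_of_divL_mem hp hq x.2.2 ?_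
    exact (Submodule.Quotient.mk_eq_zero _).1 (LinearMap.mem_ker.1 hx)
  have h4 := Submodule.finrank_mono h2
  have h5 := Submodule.finrank_mono h3
  have h6 := (Submodule.equivMapOfInjective (Submodule.subtype _)
    (Submodule.injective_subtype _) (LinearMap.ker θ)).finrank_eq
  omega

end LineCoords

end Rope

end

/-! ### The lower bound. -/

theorem mainTheorem11 {K : Type*} [Field K] (n k : ℕ) (hk : 1 ≤ k) (hkn : k + 2 ≤ n) (g : ℤ)
    (I : Ideal (Rope.CoordRing K n)) (hI : Rope.IsRope I)
    (hdg : Rope.HasDegreeGenus I ((n : ℤ) - k) g) (z : ℤ) :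
    Rope.raoMin n k g z ≤ (Rope.raoFunction I z : ℤ) := by
  obtain ⟨hhom, hsat, hCM, J, hJ, hZ, hJI⟩ := hI
  obtain ⟨c⟩ := Rope.exists_lineCoords (by omega) hJ
  have hIJ := c.le_of_zeroLocus_eq hZ
  have hp : ∀ f, MvPolynomial.X c.p * f ∈ I → f ∈ I := fun f =>
    c.mem_of_X_mul_mem hhom hsat hCM hIJ hJI
  have hq : ∀ f, MvPolynomial.X c.q * f ∈ I → f ∈ I := fun f =>
    c.swap.mem_of_X_mul_mem hhom hsat hCM hIJ hJI
  obtain ⟨w₀, hw₀⟩ := Filter.eventually_atTop.1 hdg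
  have hh : ∀ w : ℤ, (w₀ : ℤ) ≤ w →
      Rope.LineCoords.hdiff J I w = ((n : ℤ) - 1 - k) * w + -g := by
    intro w hw
    lift w to ℕ using by omega
    have h1 := hw₀ w (by exact_mod_cast hw)
    -- h is the Hilbert function of the rope minus that of the line: (n-k)w + 1 - g - (w + 1).
    have h2 := Rope.hilbertFunction_add I w
    have h3 := c.finrank_piece w
    rw [max_eq_left (by omega)] at h3
    unfold Rope.LineCoords.hdiff
    have h4 : ((n : ℤ) - 1 - k) * w = ((n : ℤ) - k) * w - w := by ring
    omega
  -- Puts z + m and z + 2m in the range where h is linear and max(w, 0) = w.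
  obtain ⟨m, hm⟩ : ∃ m : ℕ, (w₀ : ℤ) ≤ z + m ∧ 0 ≤ z + m := ⟨(w₀ - z).toNat + z.natAbs, by omega⟩
  have hfin := c.finiteDimensional_liftable (z := z) hIJ hJI hp hq (Int.natCast_nonneg w₀) hh
  have hrao := c.raoFunction_eq (z := z) (by omega) hJI hIJ hp hq
  have h1 := c.finrank_inf_span2_le (z := z) hp hq m
  rw [← hrao] at h1
  have h2 := c.le_finrank_inf_span2 hIJ hq m m z
  have hrel : ∀ w : ℤ, Rope.LineCoords.hdiff J I w + Module.finrank K (c.relPiece I w) =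
      ((n : ℤ) - 1) * max w 0 := by
    intro w
    have h3 := c.finrank_add_finrank_relPiece hIJ hJI w
    have h4 := Rope.LineCoords.finrank_coordPiece (K := K) (n := n) (by omega) w
    unfold Rope.LineCoords.hdiff
    omega
  have h3 := c.finrank_relPiece_convex hq m z
  have h4 := hrel z
  have h5 := hrel (z + m)
  have h6 := hrel (z + m + m)
  have h7 := Submodule.finrank_mono (Rope.piece_mono hIJ z)
  have h8 : (0 : ℤ) ≤ Rope.LineCoords.hdiff J I z := by
    unfold Rope.LineCoords.hdiff
    omega
  rw [max_eq_left (by omega)] at h5 h6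
  rw [hh _ (by omega)] at h5 h6
  rw [hh (z + m) (by omega), hh (z + m + m) (by omega)] at h2
  rw [Rope.raoMin_eq hk hkn]
  -- For a linear polynomial P, 2P(z+m) - P(z+2m) = P(z); the same identity underlies `h10`.
  have h9 : ((n : ℤ) - 1 - k) * z - g - Rope.LineCoords.hdiff J I z ≤ Rope.raoFunction I z := by
    have : ((n : ℤ) - 1 - k) * z - g = (((n : ℤ) - 1 - k) * (z + m) + -g) +
      (((n : ℤ) - 1 - k) * (z + m) + -g) - (((n : ℤ) - 1 - k) * (z + m + m) + -g) := by ring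
    omega
  have h10 : k * z + g ≤ Module.finrank K (c.relPiece I z) := by
    have e : k * z + g = 2 * (((n : ℤ) - 1) * (z + m) - (((n : ℤ) - 1 - k) * (z + m) + -g)) -
      (((n : ℤ) - 1) * (z + m + m) - (((n : ℤ) - 1 - k) * (z + m + m) + -g)) := by ring
    omega
  omega
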